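/- Let $d$ be a positive square-free integer, let $\mathcal{O}$ be the ring of integers of the imaginary quadratic field $\mathbb{Q}(\sqrt{-d}) \subset \mathbb{C}$, and let $|\cdot|$ denote the complex absolute value. Let $t \in \mathcal{O}$ with $|t| \geq 100$. Then every pair $(x,y) \in \mathcal{O}^2$ satisfying $$|x^4 - t x^3 y - 6 x^2 y^2 + t x y^3 + y^4| \leq 1$$ is of the form $(0,0)$, $(\xi,0)$ or $(0,\xi)$, where $\xi \in \mathcal{O}$ is a root of unity. -/

import Mathlib

open scoped NumberField

/-- The imaginary quadratic field `ℚ(√-d)`, as the subfield of `ℂ` generated by `√d * i`. -/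
noncomputable def imagQuadField (d : ℕ) : IntermediateField ℚ ℂ :=
  IntermediateField.adjoin ℚ {((Real.sqrt (d : ℝ) : ℝ) : ℂ) * Complex.I}

/-- The usual (complex) absolute value of an algebraic integer of `ℚ(√-d)`. -/
noncomputable def imagQuadAbs {d : ℕ} (z : 𝓞 (imagQuadField d)) : ℝ :=
  ‖((z : imagQuadField d) : ℂ)‖

/-- The value at `(x, y)` of the simplest quartic form
`X ^ 4 - t X ^ 3 Y - 6 X ^ 2 Y ^ 2 + t X Y ^ 3 + Y ^ 4` with parameter `t`. -/
def simplestQuartic {R : Type*} [CommRing R] (t x y : R) : R :=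
  x ^ 4 - t * x ^ 3 * y - 6 * x ^ 2 * y ^ 2 + t * x * y ^ 3 + y ^ 4

/-- `ξ` is a root of unity: some positive power of `ξ` is `1`. -/
def IsUnityRoot {R : Type*} [CommRing R] (ξ : R) : Prop :=
  ∃ n : ℕ, 0 < n ∧ ξ ^ n = 1

/-! The proof is the hypergeometric method of Thue and Siegel. Dehomogenising with `y = θ x`, the
form vanishes exactly when `t (θ - θ^3) = 1 - 6 θ^2 + θ^4`. With `w = (1 + iθ)/(1 - iθ)` this reads
`w^4 = (t + 4i)/(t - 4i)`, so the root `θ` of size about `1/|t|` comes from the fourth root of a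
number near `1`. The other roots are its images under `θ ↦ -1/θ` and `θ ↦ (1 - θ)/(1 + θ)`;
accordingly, the substitution `(-y, x)` fixes the form and `(x - y, x + y)` multiplies it by `-4`.

These symmetries leave two cases. If none of `x, y` and `x - y, x + y` is at least three times its
partner, all four linear factors are bounded below and the form exceeds `1` (`lower_of_generic`).
Otherwise one may take `3|y| ≤ |x|`, at the price of the bound `4` for the form, and then `|xθ - y|`
is at most `10 / (|t| |x|^3)` (`close_of_norm_le`). It remains to show that such a pair has `y = 0`
(`eq_zero_of_close`).

For this `θ` is approximated by `p_n/q_n`, two solutions of one three-term recurrence. The remainder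
`r_n = p_n - θ q_n` is a contour integral, hence the small solution. Roughly, `q_n` grows by the
factor `4|t|` and `r_n` shrinks by `16/|t|` at each step, so `|q_{n+1}| |r_n|^3` changes by about
`16384/|t|^2`, which exceeds `1` at `|t| = 100`. The loss is repaired by arithmetic: `p_n` and `q_n`
are `G_n` times integer polynomials in `t`, where `G_n^4` outgrows the loss
(`isPadeContent_padeContent`, `padeContent_lower`).

The linear form `p_n x - q_n y = x r_n + q_n (xθ - y)` then lies in `G_n 𝓞`, so it is zero or at
least `G_n` in absolute value. At the first `n` with `2 |x r_n| < G_n` both alternatives contradict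
the size estimates, the vanishing one through a lower bound for `|r_n|` in terms of `|r_{n-1}|`. -/

section

open Complex

/-- Solutions of the three-term recurrence satisfied by the Padé approximants of a root of the
simplest quartic form. -/
noncomputable def padeSeq (t a b : ℂ) : ℕ → ℂ
  | 0 => a
  | 1 => b
  | n + 2 => (2 * (2 * n + 3) * t * padeSeq t a b (n + 1)
      + 4 * (16 * (n + 1) ^ 2 - 1) / (n + 1) * padeSeq t a b n) / (n + 2)

lemma padeSeq_rec (t a b : ℂ) (n : ℕ) :
    (n + 2) * padeSeq t a b (n + 2) = 2 * (2 * n + 3) * t * padeSeq t a b (n + 1)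
      + 4 * (16 * (n + 1) ^ 2 - 1) / (n + 1) * padeSeq t a b n := by
  have h : ((n : ℂ) + 2) ≠ 0 := by exact_mod_cast (by omega : n + 2 ≠ 0)
  rw [padeSeq]
  field_simp

/-- A sequence with the same recurrence and the same initial values is `padeSeq`. -/
lemma eq_padeSeq (t : ℂ) (s : ℕ → ℂ)
    (h : ∀ n : ℕ, (n + 2) * s (n + 2) = 2 * (2 * n + 3) * t * s (n + 1)
      + 4 * (16 * (n + 1) ^ 2 - 1) / (n + 1) * s n) (n : ℕ) :
    s n = padeSeq t (s 0) (s 1) n := by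
  induction n using Nat.twoStepInduction with
  | zero => rfl
  | one => rfl
  | more n h0 h1 =>
    have h2 : ((n : ℂ) + 2) ≠ 0 := by exact_mod_cast (by omega : n + 2 ≠ 0)
    apply mul_left_cancel₀ h2
    rw [h, padeSeq_rec, ← h0, ← h1]

lemma padeSeq_sub_mul (t a b c d e : ℂ) (n : ℕ) :
    padeSeq t (a - e * c) (b - e * d) n = padeSeq t a b n - e * padeSeq t c d n := by
  symm
  refine eq_padeSeq t (fun n => padeSeq t a b n - e * padeSeq t c d n) (fun n => ?_) n
  have h1 := padeSeq_rec t a b n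
  have h2 := padeSeq_rec t c d n
  linear_combination h1 - e * h2

/-! ### The contour integral -/

/-- The base of the integrand. -/
noncomputable def padeKernel (z v : ℂ) : ℂ := 1 + z - v ^ 4 - z * (v⁻¹) ^ 4

lemma hasDerivAt_padeKernel (z : ℂ) {v : ℂ} (hv : v ≠ 0) :
    HasDerivAt (padeKernel z) (4 * (z * (v⁻¹) ^ 4 - v ^ 4) * v⁻¹) v := by
  have h1 := (hasDerivAt_id v).pow 4
  have h2 := ((hasDerivAt_inv hv).pow 4).const_mul z
  have h3 := (h1.const_sub (1 + z)).sub h2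
  refine h3.congr_deriv ?_
  simp
  field_simp
  ring

/-- With `D = v d/dv`, the function here is `DK` for the kernel `K`, and the lemma computes `D²K` as
a polynomial in `K`. -/
lemma hasDerivAt_padeKernel_log (z : ℂ) {v : ℂ} (hv : v ≠ 0) :
    HasDerivAt (fun v => 4 * (z * (v⁻¹) ^ 4 - v ^ 4)) (-16 * (1 + z - padeKernel z v) * v⁻¹) v := by
  have h1 := (hasDerivAt_id v).pow 4
  have h2 := ((hasDerivAt_inv hv).pow 4).const_mul z
  have h3 := (h2.sub h1).const_mul 4
  refine h3.congr_deriv ?_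
  simp [padeKernel]
  field_simp
  ring

/-- Since `D²K` and `(DK)^2` are polynomials in `K`, so is `D²(K^m)`. The primitive is `v (D - 1)
K^m` with `m = n + 2`; its derivative is `(D + 1)(D - 1) K^m = D²K^m - K^m`, a combination of three
consecutive powers of `K`. -/
lemma hasDerivAt_padePrimitive (z : ℂ) (n : ℕ) {v : ℂ} (hv : v ≠ 0) :
    HasDerivAt (fun v => v * ((n + 2) * padeKernel z v ^ (n + 1) * (4 * (z * (v⁻¹) ^ 4 - v ^ 4)))
        - v * padeKernel z v ^ (n + 2))
      (16 * (n + 2) * (n + 1) * (1 - z) ^ 2 * padeKernel z v ^ n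
        - 16 * (n + 2) * (2 * n + 3) * (1 + z) * padeKernel z v ^ (n + 1)
        + (16 * (n + 2) ^ 2 - 1) * padeKernel z v ^ (n + 2)) v := by
  have hk := hasDerivAt_padeKernel z hv
  have hl := hasDerivAt_padeKernel_log z hv
  have h1 := (hasDerivAt_id v).mul (((hk.pow (n + 1)).const_mul ((n : ℂ) + 2)).mul hl)
  have h2 := (hasDerivAt_id v).mul (hk.pow (n + 2))
  refine (h1.sub h2).congr_deriv ?_
  have hsq : (4 * (z * (v⁻¹) ^ 4 - v ^ 4)) ^ 2 = 16 * ((1 + z - padeKernel z v) ^ 2 - 4 * z) := by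
    simp only [padeKernel]
    field_simp
    ring
  set k := padeKernel z v with hkdef
  set l := 4 * (z * (v⁻¹) ^ 4 - v ^ 4) with hl'
  have hvv : v * v⁻¹ = 1 := mul_inv_cancel₀ hv
  simp only [Nat.add_sub_cancel, id, Pi.mul_apply, Pi.pow_apply]
  simp only [show n + 2 - 1 = n + 1 from rfl]
  push_cast
  simp only [pow_succ] at hsq ⊢
  linear_combination (n + 2) * (n + 1) * k ^ n * hsq + ((n + 2) * (n + 1) * k ^ n * l * l
    + (n + 2) * k ^ n * k * (-16 * (1 + z - k)) - (n + 2) * k ^ n * k * l) * hvv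

/-- The integral of the powers of the kernel along the segment from `1` to `w`. -/
noncomputable def padeIntegral (z w : ℂ) (n : ℕ) : ℂ :=
  ∫ s in (0 : ℝ)..1, padeKernel z (1 + s * (w - 1)) ^ n * (w - 1)

lemma segment_ne_zero {w : ℂ} (hw : ‖w - 1‖ ≤ 1 / 10) {s : ℝ} (hs : s ∈ Set.uIcc (0 : ℝ) 1) :
    (1 + s * (w - 1) : ℂ) ≠ 0 := by
  rw [Set.uIcc_of_le zero_le_one] at hs
  intro h
  have h1 : (s : ℂ) * (w - 1) = -1 := by linear_combination h
  have h2 : ‖(s : ℂ) * (w - 1)‖ = 1 := by rw [h1]; simp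
  rw [norm_mul, Complex.norm_real, Real.norm_of_nonneg hs.1] at h2
  nlinarith [hs.1, hs.2, norm_nonneg (w - 1)]

lemma continuousOn_padeKernel_segment (z : ℂ) {w : ℂ} (hw : ‖w - 1‖ ≤ 1 / 10) (n : ℕ) :
    ContinuousOn (fun s : ℝ => padeKernel z (1 + s * (w - 1)) ^ n * (w - 1)) (Set.uIcc 0 1) := by
  unfold padeKernel
  have : ContinuousOn (fun s : ℝ => (1 + s * (w - 1) : ℂ)⁻¹) (Set.uIcc 0 1) :=
    ContinuousOn.inv₀ (by fun_prop) fun s hs => segment_ne_zero hw hs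
  fun_prop

lemma intervalIntegrable_padeKernel (z : ℂ) {w : ℂ} (hw : ‖w - 1‖ ≤ 1 / 10) (n : ℕ) :
    IntervalIntegrable (fun s : ℝ => padeKernel z (1 + s * (w - 1)) ^ n * (w - 1))
      MeasureTheory.volume 0 1 :=
  (continuousOn_padeKernel_segment z hw n).intervalIntegrable

lemma hasDerivAt_segment (w : ℂ) (s : ℝ) :
    HasDerivAt (fun s : ℝ => (1 + s * (w - 1) : ℂ)) (w - 1) s := by
  have h := ((hasDerivAt_id s).ofReal_comp.mul_const (w - 1)).const_add 1
  simpa using h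

lemma padeKernel_one (z : ℂ) : padeKernel z 1 = 0 := by simp [padeKernel]

lemma padeKernel_fourthRoot {w : ℂ} (hw : w ≠ 0) : padeKernel (w ^ 4) w = 0 := by
  simp only [padeKernel]
  field_simp
  ring

/-- The kernel vanishes at both endpoints `1` and `w`, so the primitive contributes no boundary
terms and its derivative integrates to a recurrence. -/
lemma padeIntegral_rec {w : ℂ} (hw : ‖w - 1‖ ≤ 1 / 10) (n : ℕ) :
    (16 * (n + 2) ^ 2 - 1) * padeIntegral (w ^ 4) w (n + 2) =
      16 * (n + 2) * (2 * n + 3) * (1 + w ^ 4) * padeIntegral (w ^ 4) w (n + 1)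
      - 16 * (n + 2) * (n + 1) * (1 - w ^ 4) ^ 2 * padeIntegral (w ^ 4) w n := by
  have hw0 : w ≠ 0 := by
    have := segment_ne_zero hw (s := 1) (by simp)
    simpa using this
  set z := w ^ 4 with hz
  have hd : ∀ s ∈ Set.uIcc (0 : ℝ) 1, HasDerivAt
      (fun s : ℝ => (fun v => v * ((n + 2) * padeKernel z v ^ (n + 1)
        * (4 * (z * (v⁻¹) ^ 4 - v ^ 4))) - v * padeKernel z v ^ (n + 2)) (1 + s * (w - 1) : ℂ))
      (16 * (n + 2) * (n + 1) * (1 - z) ^ 2 * (padeKernel z (1 + s * (w - 1)) ^ n * (w - 1))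
        - 16 * (n + 2) * (2 * n + 3) * (1 + z)
          * (padeKernel z (1 + s * (w - 1)) ^ (n + 1) * (w - 1))
        + (16 * (n + 2) ^ 2 - 1) * (padeKernel z (1 + s * (w - 1)) ^ (n + 2) * (w - 1))) s := by
    intro s hs
    have h := (hasDerivAt_padePrimitive z n (segment_ne_zero hw hs)).comp s (hasDerivAt_segment w s)
    refine h.congr_deriv ?_
    ring
  have i0 := (intervalIntegrable_padeKernel z hw n).const_mul
    (16 * (n + 2) * (n + 1) * (1 - z) ^ 2)
  have i1 := (intervalIntegrable_padeKernel z hw (n + 1)).const_mul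
    (16 * (n + 2) * (2 * n + 3) * (1 + z))
  have i2 := (intervalIntegrable_padeKernel z hw (n + 2)).const_mul
    (16 * ((n : ℂ) + 2) ^ 2 - 1)
  have h := intervalIntegral.integral_eq_sub_of_hasDerivAt hd ((i0.sub i1).add i2)
  rw [intervalIntegral.integral_add (i0.sub i1) i2, intervalIntegral.integral_sub i0 i1] at h
  simp only [intervalIntegral.integral_const_mul] at h
  have e1 : (1 + ((1 : ℝ) : ℂ) * (w - 1)) = w := by simp
  have e0 : (1 + ((0 : ℝ) : ℂ) * (w - 1)) = 1 := by simp
  simp only [e1, e0, hz, padeKernel_one, padeKernel_fourthRoot hw0] at h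
  simp only [← hz] at h
  simp only [ne_eq, Nat.add_eq_zero_iff, one_ne_zero, and_false, not_false_eq_true, zero_pow,
    OfNat.ofNat_ne_zero, mul_zero, zero_mul, sub_zero] at h
  simp only [padeIntegral]
  linear_combination h

lemma padeIntegral_zero (z w : ℂ) : padeIntegral z w 0 = w - 1 := by
  simp [padeIntegral]

lemma padeIntegral_one {w : ℂ} (hw : ‖w - 1‖ ≤ 1 / 10) :
    padeIntegral (w ^ 4) w 1 =
      w * (4 / 3 + 4 * w ^ 4 / 5) - (4 / 5 + 4 * w ^ 4 / 3) := by
  have hw0 : w ≠ 0 := by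
    have := segment_ne_zero hw (s := 1) (by simp)
    simpa using this
  have hd : ∀ s ∈ Set.uIcc (0 : ℝ) 1, HasDerivAt
      (fun s : ℝ => (fun v => (1 + w ^ 4) * v - v ^ 5 / 5 + w ^ 4 * (v⁻¹) ^ 3 / 3)
        (1 + s * (w - 1) : ℂ))
      (padeKernel (w ^ 4) (1 + s * (w - 1)) ^ 1 * (w - 1)) s := by
    intro s hs
    have hv := segment_ne_zero hw hs
    have h := HasDerivAt.comp s (((((hasDerivAt_id (1 + s * (w - 1) : ℂ)).const_mul (1 + w ^ 4)).sub
      (((hasDerivAt_id _).pow 5).div_const 5)).add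
      ((((hasDerivAt_inv hv).pow 3).const_mul (w ^ 4)).div_const 3))) (hasDerivAt_segment w s)
    refine h.congr_deriv ?_
    simp [padeKernel]
    left
    field_simp
    ring
  have h := intervalIntegral.integral_eq_sub_of_hasDerivAt hd
    (intervalIntegrable_padeKernel _ hw 1)
  rw [padeIntegral, h]
  simp
  field_simp
  ring

end

/-! ### Size of the integrals and construction of the small root -/

section

open Complex

/-- The kernel factors as `(v^4 - 1)(w^4 - v^4) / v^4`, and each of the two factors in the numerator
is of order `δ`. -/
lemma norm_padeKernel_le {w v : ℂ} {δ : ℝ} (hδ : δ ≤ 1 / 10) (hw : ‖w - 1‖ ≤ δ)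
    (hv : ‖v - 1‖ ≤ δ) (hwv : ‖w - v‖ ≤ δ) : ‖padeKernel (w ^ 4) v‖ ≤ 40 * δ ^ 2 := by
  have hδ0 : 0 ≤ δ := (norm_nonneg _).trans hw
  have hv9 : 9 / 10 ≤ ‖v‖ := by
    have := norm_sub_norm_le (1 : ℂ) v
    rw [norm_one, norm_sub_rev] at this
    linarith
  have hv0 : v ≠ 0 := by
    rintro rfl
    norm_num at hv9
  have hv11 : ‖v‖ ≤ 11 / 10 := by
    have := norm_add_le (v - 1) 1
    rw [sub_add_cancel, norm_one] at this
    linarith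
  have hw11 : ‖w‖ ≤ 11 / 10 := by
    have := norm_add_le (w - 1) 1
    rw [sub_add_cancel, norm_one] at this
    linarith
  have hfac : padeKernel (w ^ 4) v =
      ((v - 1) * ((v + 1) * (v ^ 2 + 1))) * ((w - v) * ((w + v) * (w ^ 2 + v ^ 2))) / v ^ 4 := by
    simp only [padeKernel]
    field_simp
    ring
  have a1 : ‖v + 1‖ ≤ 21 / 10 := (norm_add_le _ _).trans (by rw [norm_one]; linarith)
  have a2 : ‖v ^ 2 + 1‖ ≤ 221 / 100 := (norm_add_le _ _).trans (by
    rw [norm_one, norm_pow]; nlinarith [norm_nonneg v])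
  have a3 : ‖w + v‖ ≤ 22 / 10 := (norm_add_le _ _).trans (by linarith)
  have a4 : ‖w ^ 2 + v ^ 2‖ ≤ 242 / 100 := (norm_add_le _ _).trans (by
    rw [norm_pow, norm_pow]; nlinarith [norm_nonneg v, norm_nonneg w])
  have a5 : (9 / 10 : ℝ) ^ 4 ≤ ‖v‖ ^ 4 := by gcongr
  rw [hfac, norm_div, norm_pow, div_le_iff₀ (by positivity), norm_mul, norm_mul, norm_mul, norm_mul,
    norm_mul]
  calc ‖v - 1‖ * (‖v + 1‖ * ‖v ^ 2 + 1‖) * (‖w - v‖ * (‖w + v‖ * ‖w ^ 2 + v ^ 2‖))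
      ≤ δ * (21 / 10 * (221 / 100)) * (δ * (22 / 10 * (242 / 100))) := by gcongr
    _ ≤ 40 * δ ^ 2 * (9 / 10 : ℝ) ^ 4 := by nlinarith [sq_nonneg δ]
    _ ≤ _ := by gcongr

lemma norm_padeIntegral_le {w : ℂ} {δ : ℝ} (hδ : δ ≤ 1 / 10) (hw : ‖w - 1‖ ≤ δ) (n : ℕ) :
    ‖padeIntegral (w ^ 4) w n‖ ≤ (40 * δ ^ 2) ^ n * δ := by
  have hδ0 : 0 ≤ δ := (norm_nonneg _).trans hw
  have h := intervalIntegral.norm_integral_le_of_norm_le_const (a := (0 : ℝ)) (b := 1)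
    (f := fun s : ℝ => padeKernel (w ^ 4) (1 + s * (w - 1)) ^ n * (w - 1))
    (C := (40 * δ ^ 2) ^ n * δ) (by
      intro s hs
      rw [Set.uIoc_of_le zero_le_one] at hs
      rw [norm_mul, norm_pow]
      have h1 : ‖(1 + s * (w - 1) : ℂ) - 1‖ ≤ δ := by
        rw [add_sub_cancel_left, norm_mul, Complex.norm_real, Real.norm_of_nonneg hs.1.le]
        nlinarith [hs.1, hs.2, norm_nonneg (w - 1)]
      have h2 : ‖w - (1 + s * (w - 1) : ℂ)‖ ≤ δ := by
        have : w - (1 + s * (w - 1) : ℂ) = ((1 - s : ℝ) : ℂ) * (w - 1) := by push_cast; ring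
        rw [this, norm_mul, Complex.norm_real, Real.norm_of_nonneg (by linarith [hs.2])]
        nlinarith [hs.1, hs.2, norm_nonneg (w - 1)]
      have := norm_padeKernel_le hδ hw h1 h2
      gcongr)
  simpa [padeIntegral] using h

/-- The normalising factor between the contour integrals and the Padé remainders. -/
noncomputable def padeScale : ℕ → ℝ
  | 0 => 1
  | n + 1 => padeScale n * ((16 * (n + 1) ^ 2 - 1) / (16 * (n + 1) ^ 2))

lemma padeScale_mem (n : ℕ) : 0 ≤ padeScale n ∧ padeScale n ≤ 1 := by
  induction n with
  | zero => simp [padeScale]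
  | succ n ih =>
    have h1 : (0 : ℝ) ≤ (16 * (n + 1) ^ 2 - 1) / (16 * (n + 1) ^ 2) := by
      apply div_nonneg _ (by positivity)
      nlinarith [Nat.cast_nonneg (α := ℝ) n]
    have h2 : ((16 * (n + 1) ^ 2 - 1) / (16 * (n + 1) ^ 2) : ℝ) ≤ 1 := by
      rw [div_le_one (by positivity)]
      linarith
    exact ⟨mul_nonneg ih.1 h1, mul_le_one₀ ih.2 h1 h2⟩

/-- Both sides satisfy the same recurrence and agree at `0` and `1`. Multiplication by `(t - 4i)^n`
turns `1 + w^4` into `2t` and `(1 - w^4)^2` into `-64`, while `padeScale` adjusts the factors `16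
k^2 - 1`. -/
lemma padeSeq_eq_integral {t w : ℂ} (hw : ‖w - 1‖ ≤ 1 / 10) (hw1 : 1 + w ≠ 0)
    (ht : w ^ 4 * (t - 4 * I) = t + 4 * I) (n : ℕ) :
    padeSeq t (-(I * (1 - w) / (1 + w))) (2 - 2 * t * (I * (1 - w) / (1 + w))) n
      = I / (1 + w) * (padeScale n * (t - 4 * I) ^ n * padeIntegral (w ^ 4) w n) := by
  have h := eq_padeSeq t
    (fun n => I / (1 + w) * (padeScale n * (t - 4 * I) ^ n * padeIntegral (w ^ 4) w n)) ?_ n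
  · rw [h]
    congr 1
    · rw [padeIntegral_zero]
      simp [padeScale]
      field_simp
      ring
    · rw [padeIntegral_one hw]
      simp [padeScale]
      field_simp
      linear_combination (300 * I - 180 * w * I) * ht + 480 * (1 + w) * I_sq
  · intro n
    have h1 := padeIntegral_rec hw n
    have hn1 : ((n : ℂ) + 1) ≠ 0 := by exact_mod_cast (by omega : n + 1 ≠ 0)
    have hn2 : ((n : ℂ) + 2) ≠ 0 := by exact_mod_cast (by omega : n + 2 ≠ 0)
    have k1 : (t - 4 * I) * (1 + w ^ 4) = 2 * t := by linear_combination ht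
    have k2 : ((t - 4 * I) * (1 - w ^ 4)) ^ 2 = -64 := by
      have : (t - 4 * I) * (1 - w ^ 4) = -8 * I := by linear_combination -ht
      rw [this, mul_pow, I_sq]
      norm_num
    have s2 : 16 * ((n : ℂ) + 2) ^ 2 * padeScale (n + 2)
        = (16 * (n + 2) ^ 2 - 1) * padeScale (n + 1) := by
      simp only [padeScale]
      push_cast
      rw [show ((n : ℂ) + 1 + 1) = n + 2 by ring]
      field_simp
    have s1 : 16 * ((n : ℂ) + 1) ^ 2 * padeScale (n + 1)
        = (16 * (n + 1) ^ 2 - 1) * padeScale n := by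
      simp only [padeScale]
      push_cast
      field_simp
    set c := I / (1 + w)
    set κ := t - 4 * I
    set J0 := padeIntegral (w ^ 4) w n
    set J1 := padeIntegral (w ^ 4) w (n + 1)
    set J2 := padeIntegral (w ^ 4) w (n + 2)
    set L0 : ℂ := ((padeScale n : ℝ) : ℂ)
    set L1 : ℂ := ((padeScale (n + 1) : ℝ) : ℂ)
    set L2 : ℂ := ((padeScale (n + 2) : ℝ) : ℂ)
    have e0 : 4 * (16 * ((n : ℂ) + 1) ^ 2 - 1) / (n + 1) * (c * (L0 * κ ^ n * J0))
        = 64 * (n + 1) * (c * (L1 * κ ^ n * J0)) := by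
      field_simp
      linear_combination -4 * J0 * c * κ ^ n * s1
    rw [e0]
    apply mul_left_cancel₀ hn2
    apply mul_left_cancel₀ (by norm_num : (16 : ℂ) ≠ 0)
    rw [pow_succ κ (n + 1), pow_succ κ n]
    linear_combination c * κ ^ n * κ * κ * J2 * s2 + c * κ ^ n * κ * κ * L1 * h1
      + c * κ ^ n * κ * L1 * J1 * 16 * (n + 2) * (2 * n + 3) * k1
      - c * κ ^ n * L1 * J0 * 16 * (n + 2) * (n + 1) * k2

/-- The root is the principal one, `exp (log (1 + e) / 4)` with `1 + e = (t + 4i)/(t - 4i)`. From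
`|log (1 + e)| ≤ 3/2 |e|` and `|exp u - 1| ≤ 2 |u|` follows `|w - 1| ≤ 3/4 |e|`, and `|t - 4i| |e| =
8` gives the constant `6`. -/
lemma exists_fourthRoot {t : ℂ} (ht : 100 ≤ ‖t‖) :
    ∃ w : ℂ, w ^ 4 * (t - 4 * I) = t + 4 * I ∧ ‖w - 1‖ ≤ 1 / 10 ∧
      w ≠ 1 ∧ 96 / 100 * ‖t‖ ≤ ‖t - 4 * I‖ ∧ ‖t - 4 * I‖ * ‖w - 1‖ ≤ 6 := by
  have hk : 96 / 100 * ‖t‖ ≤ ‖t - 4 * I‖ := by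
    have := norm_sub_norm_le t (4 * I)
    simp at this
    linarith
  have hk0 : t - 4 * I ≠ 0 := by
    intro h
    rw [h, norm_zero] at hk
    linarith
  set e := 8 * I / (t - 4 * I) with he
  have hen : ‖t - 4 * I‖ * ‖e‖ = 8 := by
    rw [← norm_mul, he, mul_div_cancel₀ _ hk0]
    simp
  have he12 : ‖e‖ ≤ 1 / 12 := by
    nlinarith [norm_nonneg e]
  have hl := Complex.norm_log_one_add_half_le_self (z := e) (by linarith)
  have hl4 : ‖Complex.log (1 + e) / 4‖ ≤ 3 / 8 * ‖e‖ := by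
    rw [norm_div]
    norm_num
    linarith
  have hexp := Complex.norm_exp_sub_one_le (x := Complex.log (1 + e) / 4) (by linarith)
  have h1e : 1 + e ≠ 0 := by
    intro h
    have : e = -1 := by linear_combination h
    rw [this, norm_neg, norm_one] at he12
    norm_num at he12
  have hw4 : Complex.exp (Complex.log (1 + e) / 4) ^ 4 = 1 + e := by
    rw [← Complex.exp_nat_mul]
    push_cast
    rw [mul_div_cancel₀ _ (by norm_num : (4 : ℂ) ≠ 0), Complex.exp_log h1e]
  refine ⟨Complex.exp (Complex.log (1 + e) / 4), ?_, by linarith, ?_, hk, ?_⟩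
  · rw [hw4, he, add_mul, div_mul_cancel₀ _ hk0]
    ring
  · intro h
    rw [h, one_pow] at hw4
    have : e = 0 := by linear_combination -hw4
    rw [this, norm_zero, mul_zero] at hen
    norm_num at hen
  · have h6 : ‖Complex.exp (Complex.log (1 + e) / 4) - 1‖ ≤ 3 / 4 * ‖e‖ := by linarith
    calc ‖t - 4 * I‖ * ‖Complex.exp (Complex.log (1 + e) / 4) - 1‖
        ≤ ‖t - 4 * I‖ * (3 / 4 * ‖e‖) := by gcongr
      _ = 6 := by linear_combination 3 / 4 * hen

/-- The denominators of the Padé approximants. -/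
noncomputable def padeDen (t : ℂ) : ℕ → ℂ := padeSeq t 1 (2 * t)

/-- The numerators of the Padé approximants. -/
noncomputable def padeNum (t : ℂ) : ℕ → ℂ := padeSeq t 0 2

/-- The remainders of the Padé approximants of `θ`. -/
noncomputable def padeRem (t θ : ℂ) (n : ℕ) : ℂ := padeNum t n - θ * padeDen t n

lemma padeRem_eq (t θ : ℂ) (n : ℕ) : padeRem t θ n = padeSeq t (-θ) (2 - 2 * t * θ) n := by
  rw [padeRem, padeNum, padeDen, ← padeSeq_sub_mul]
  congr 1 <;> ring

/-- The small root of the dehomogenised form, with an exponential bound for the remainders. -/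
lemma exists_small_root {t : ℂ} (ht : 100 ≤ ‖t‖) :
    ∃ θ : ℂ, θ ≠ 0 ∧ ‖t‖ * ‖θ‖ ≤ 101 / 100 ∧ t * (θ - θ ^ 3) = 1 - 6 * θ ^ 2 + θ ^ 4 ∧
      ∀ n, ‖padeRem t θ n‖ ≤ 50 ^ n := by
  obtain ⟨w, hw4, hw, hne, hk, hkw⟩ := exists_fourthRoot ht
  have hw19 : 19 / 10 ≤ ‖1 + w‖ := by
    have := norm_sub_norm_le (2 : ℂ) (1 - w)
    rw [norm_sub_rev 1 w, show (2 : ℂ) - (1 - w) = 1 + w by ring] at this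
    norm_num at this
    linarith
  have hw1 : 1 + w ≠ 0 := by
    intro h
    rw [h, norm_zero] at hw19
    norm_num at hw19
  -- Inverse Cayley transform: `w = (1 + iθ)/(1 - iθ)`.
  set θ := I * (1 - w) / (1 + w) with hθ
  have hθ0 : θ ≠ 0 := by
    rw [hθ]
    refine div_ne_zero (mul_ne_zero I_ne_zero ?_) hw1
    intro h
    exact hne (by linear_combination -h)
  have hrel : t * (θ - θ ^ 3) = 1 - 6 * θ ^ 2 + θ ^ 4 := by
    have h1 : θ * (1 + w) = I * (1 - w) := by
      rw [hθ]
      field_simp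
    have h2 : w * (1 - I * θ) = 1 + I * θ := by
      linear_combination (-I) * h1 - (1 - w) * I_sq
    have h3 : (1 + I * θ) ^ 4 * (t - 4 * I) = (t + 4 * I) * (1 - I * θ) ^ 4 := by
      rw [← h2, mul_pow]
      linear_combination (1 - I * θ) ^ 4 * hw4
    have h4 : 8 * I * (t * (θ - θ ^ 3)) = 8 * I * (1 - 6 * θ ^ 2 + θ ^ 4) := by
      have I3 : I ^ 3 = -I := by rw [pow_succ, I_sq]; ring
      have I4 : I ^ 4 = 1 := by rw [show 4 = 2 * 2 from rfl, pow_mul, I_sq]; norm_num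
      have I5 : I ^ 5 = I := by rw [pow_succ, I4]; ring
      ring_nf at h3 ⊢
      simp only [I_sq, I3, I4, I5] at h3
      linear_combination h3
    exact mul_left_cancel₀ (mul_ne_zero (by norm_num) I_ne_zero) h4
  have hθs : ‖θ‖ ≤ 1 / 30 := by
    have h1 : ‖θ‖ * ‖1 + w‖ = ‖w - 1‖ := by
      rw [← norm_mul, hθ, div_mul_cancel₀ _ hw1, norm_mul, norm_I, one_mul, norm_sub_rev]
    have h2 : ‖w - 1‖ ≤ 625 / 10000 := by nlinarith [norm_nonneg (w - 1)]
    have h3 : 2 - 625 / 10000 ≤ ‖1 + w‖ := by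
      have := norm_sub_norm_le (2 : ℂ) (1 - w)
      rw [norm_sub_rev 1 w, show (2 : ℂ) - (1 - w) = 1 + w by ring] at this
      norm_num at this
      linarith
    nlinarith [norm_nonneg θ]
  refine ⟨θ, hθ0, ?_, hrel, fun n => ?_⟩
  · have h1 : ‖t‖ * ‖θ‖ * ‖1 - θ ^ 2‖ = ‖1 - 6 * θ ^ 2 + θ ^ 4‖ := by
      rw [← norm_mul, ← norm_mul, ← hrel]
      congr 1
      ring
    have h2 : ‖1 - 6 * θ ^ 2 + θ ^ 4‖ ≤ 1 + 6 * ‖θ‖ ^ 2 + ‖θ‖ ^ 4 := by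
      refine (norm_add_le _ _).trans ?_
      rw [norm_pow]
      gcongr
      refine (norm_sub_le _ _).trans ?_
      simp
    have h3 : 1 - ‖θ‖ ^ 2 ≤ ‖1 - θ ^ 2‖ := by
      have := norm_sub_norm_le (1 : ℂ) (θ ^ 2)
      rwa [norm_one, norm_pow] at this
    have h4 : ‖θ‖ ^ 2 ≤ 1 / 900 := by
      calc ‖θ‖ ^ 2 ≤ (1 / 30) ^ 2 := by gcongr
        _ = 1 / 900 := by norm_num
    have h5 : ‖θ‖ ^ 4 ≤ 1 / 900 * (1 / 900) := by
      rw [show ‖θ‖ ^ 4 = ‖θ‖ ^ 2 * ‖θ‖ ^ 2 by ring]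
      gcongr
    have h6 : ‖t‖ * ‖θ‖ * (899 / 900) ≤ ‖t‖ * ‖θ‖ * ‖1 - θ ^ 2‖ := by
      gcongr
      linarith
    linarith
  · rw [padeRem_eq, padeSeq_eq_integral hw hw1 hw4, norm_mul, norm_mul, norm_mul, norm_pow,
      norm_div, norm_I, Complex.norm_real, Real.norm_of_nonneg (padeScale_mem n).1]
    have h1 := norm_padeIntegral_le hw le_rfl n
    have h2 := padeScale_mem n
    have h3 : ‖t - 4 * I‖ * (40 * ‖w - 1‖ ^ 2) ≤ 50 := by
      nlinarith [norm_nonneg (w - 1)]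
    calc 1 / ‖1 + w‖ * (padeScale n * ‖t - 4 * I‖ ^ n * ‖padeIntegral (w ^ 4) w n‖)
        ≤ 1 / (19 / 10) * (1 * ‖t - 4 * I‖ ^ n * ((40 * ‖w - 1‖ ^ 2) ^ n * (1 / 10))) := by
          have := h2.1
          have := h1.trans (mul_le_mul_of_nonneg_left hw (by positivity))
          have := h2.2
          gcongr
      _ = 1 / 19 * (‖t - 4 * I‖ * (40 * ‖w - 1‖ ^ 2)) ^ n := by rw [mul_pow]; ring
      _ ≤ 1 / 19 * 50 ^ n := by gcongr
      _ ≤ 50 ^ n := by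
        have : (0 : ℝ) ≤ 50 ^ n := by positivity
        linarith

end

/-! ### Growth of denominators and decay of remainders -/

section

open Complex

/-- The last coefficient of the recurrence. -/
noncomputable def padeCoef (n : ℕ) : ℝ := 4 * (16 * (n + 1) ^ 2 - 1) / (n + 1)

lemma padeCoef_le (n : ℕ) : padeCoef n ≤ 64 * (n + 1) := by
  rw [padeCoef, div_le_iff₀ (by positivity)]
  nlinarith

lemma le_padeCoef (n : ℕ) : 60 * ((n : ℝ) + 1) ≤ padeCoef n := by
  rw [padeCoef, le_div_iff₀ (by positivity)]
  nlinarith [Nat.cast_nonneg (α := ℝ) n]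

lemma norm_natCast_add_two (n : ℕ) : ‖(n : ℂ) + 2‖ = n + 2 := by
  exact_mod_cast Complex.norm_natCast (n + 2)

lemma norm_padeLeading (n : ℕ) (t : ℂ) : ‖2 * (2 * (n : ℂ) + 3) * t‖ = 2 * (2 * n + 3) * ‖t‖ := by
  rw [norm_mul]
  congr 1
  exact_mod_cast Complex.norm_natCast (2 * (2 * n + 3))

lemma norm_padeCoef (n : ℕ) : ‖(4 * (16 * ((n : ℂ) + 1) ^ 2 - 1) / (n + 1))‖ = padeCoef n := by
  have h : (4 * (16 * ((n : ℂ) + 1) ^ 2 - 1) / (n + 1)) = ((padeCoef n : ℝ) : ℂ) := by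
    simp [padeCoef]
  rw [h, Complex.norm_real, Real.norm_of_nonneg]
  exact le_trans (by positivity) (le_padeCoef n)

lemma padeSeq_upper (t a b : ℂ) (n : ℕ) :
    (n + 2) * ‖padeSeq t a b (n + 2)‖ ≤
      2 * (2 * n + 3) * ‖t‖ * ‖padeSeq t a b (n + 1)‖ + padeCoef n * ‖padeSeq t a b n‖ := by
  rw [← norm_natCast_add_two, ← norm_mul, padeSeq_rec, ← norm_padeLeading, ← norm_padeCoef,
    ← norm_mul, ← norm_mul]
  exact norm_add_le _ _

lemma padeSeq_lower (t a b : ℂ) (n : ℕ) :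
    2 * (2 * n + 3) * ‖t‖ * ‖padeSeq t a b (n + 1)‖ ≤
      (n + 2) * ‖padeSeq t a b (n + 2)‖ + padeCoef n * ‖padeSeq t a b n‖ := by
  rw [← norm_natCast_add_two, ← norm_padeLeading, ← norm_padeCoef,
    ← norm_mul, ← norm_mul, ← norm_mul]
  refine le_trans (le_of_eq ?_) (norm_sub_le _ _)
  rw [padeSeq_rec, add_sub_cancel_right]

lemma padeSeq_back (t a b : ℂ) (n : ℕ) :
    padeCoef n * ‖padeSeq t a b n‖ ≤
      (n + 2) * ‖padeSeq t a b (n + 2)‖ + 2 * (2 * n + 3) * ‖t‖ * ‖padeSeq t a b (n + 1)‖ := by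
  rw [← norm_natCast_add_two, ← norm_padeLeading, ← norm_padeCoef,
    ← norm_mul, ← norm_mul, ← norm_mul]
  refine le_trans (le_of_eq ?_) (norm_sub_le _ _)
  rw [padeSeq_rec, add_sub_cancel_left]

/-- Once a solution fails to decrease by a factor `2`, the leading coefficient of size at least `200
(2n + 3)` dominates. The conclusion implies the hypothesis at the next index, so the growth
persists. Hence the crude bound `50 ^ n` already forces decay from the start. -/
lemma padeSeq_growth {t : ℂ} (ht : 100 ≤ ‖t‖) (a b : ℂ) (n : ℕ)
    (h : ‖padeSeq t a b n‖ ≤ 2 * ‖padeSeq t a b (n + 1)‖) :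
    100 * ‖padeSeq t a b (n + 1)‖ ≤ ‖padeSeq t a b (n + 2)‖ := by
  have h1 := padeSeq_lower t a b n
  have h2 : padeCoef n * ‖padeSeq t a b n‖ ≤ 64 * (n + 1) * (2 * ‖padeSeq t a b (n + 1)‖) := by
    gcongr
    exact padeCoef_le n
  have h3 : 2 * (2 * n + 3) * 100 * ‖padeSeq t a b (n + 1)‖
      ≤ 2 * (2 * n + 3) * ‖t‖ * ‖padeSeq t a b (n + 1)‖ := by gcongr
  have hn : (0 : ℝ) < n + 2 := by positivity
  refine le_of_mul_le_mul_left ?_ hn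
  have : 0 ≤ (n : ℝ) * ‖padeSeq t a b (n + 1)‖ := by positivity
  nlinarith [norm_nonneg (padeSeq t a b (n + 1))]

lemma padeSeq_growth_iterate {t : ℂ} (ht : 100 ≤ ‖t‖) (a b : ℂ) (n : ℕ)
    (h : ‖padeSeq t a b n‖ ≤ 2 * ‖padeSeq t a b (n + 1)‖) (j : ℕ) :
    100 ^ j * ‖padeSeq t a b (n + 1)‖ ≤ ‖padeSeq t a b (n + 1 + j)‖ ∧
      ‖padeSeq t a b (n + j)‖ ≤ 2 * ‖padeSeq t a b (n + j + 1)‖ := by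
  induction j with
  | zero => simpa using h
  | succ j ih =>
    have h1 := padeSeq_growth ht a b (n + j) ih.2
    rw [show n + 1 + j = n + j + 1 by ring] at ih
    rw [show n + 1 + (j + 1) = n + j + 2 by ring, show n + (j + 1) = n + j + 1 by ring,
      show n + j + 1 + 1 = n + j + 2 by ring]
    constructor
    · calc 100 ^ (j + 1) * ‖padeSeq t a b (n + 1)‖
          = 100 * (100 ^ j * ‖padeSeq t a b (n + 1)‖) := by ring
        _ ≤ 100 * ‖padeSeq t a b (n + j + 1)‖ := by gcongr; exact ih.1
        _ ≤ _ := h1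
    · linarith [norm_nonneg (padeSeq t a b (n + j + 1))]

/-- A solution of the recurrence that grows slowly is decreasing. -/
lemma padeSeq_decay {t : ℂ} (ht : 100 ≤ ‖t‖) (a b : ℂ)
    (hb : ∀ n, ‖padeSeq t a b n‖ ≤ 50 ^ n) (n : ℕ) :
    2 * ‖padeSeq t a b (n + 1)‖ ≤ ‖padeSeq t a b n‖ := by
  by_contra! hlt
  have hpos : 0 < ‖padeSeq t a b (n + 1)‖ := by
    have := norm_nonneg (padeSeq t a b n)
    linarith
  -- Growth by `100` per step overtakes `50 ^ n`, since their ratio gains a factor `2` per step.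
  obtain ⟨j, hj⟩ := pow_unbounded_of_one_lt (50 ^ (n + 1) / ‖padeSeq t a b (n + 1)‖)
    (one_lt_two (α := ℝ))
  have h1 := (padeSeq_growth_iterate ht a b n (by linarith) j).1.trans (hb _)
  rw [div_lt_iff₀ hpos] at hj
  have h2 : (50 : ℝ) ^ (n + 1 + j) < 100 ^ j * ‖padeSeq t a b (n + 1)‖ := by
    calc (50 : ℝ) ^ (n + 1 + j) = 50 ^ j * 50 ^ (n + 1) := by ring
      _ < 50 ^ j * (2 ^ j * ‖padeSeq t a b (n + 1)‖) := by gcongr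
      _ = 100 ^ j * ‖padeSeq t a b (n + 1)‖ := by
        rw [← mul_assoc, ← mul_pow]
        norm_num
  linarith

/-- For a decaying solution the term `s (n + 2)` is negligible, so the other two terms of the
recurrence nearly balance. This gives the decay rate `16/|t|` up to a small relative error; the
lower bound that follows uses the same balance. -/
lemma padeSeq_decay_sharp {t : ℂ} (ht : 100 ≤ ‖t‖) (a b : ℂ)
    (hb : ∀ n, ‖padeSeq t a b n‖ ≤ 50 ^ n) (n : ℕ) :
    (2 * n + 3) * ‖t‖ * ‖padeSeq t a b (n + 1)‖ ≤ 1603 / 50 * (n + 1) * ‖padeSeq t a b n‖ := by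
  have h1 := padeSeq_lower t a b n
  have h2 := padeSeq_decay ht a b hb (n + 1)
  have h3 : padeCoef n * ‖padeSeq t a b n‖ ≤ 64 * (n + 1) * ‖padeSeq t a b n‖ := by
    gcongr
    exact padeCoef_le n
  rw [show n + 1 + 1 = n + 2 from rfl] at h2
  have hx := norm_nonneg (padeSeq t a b (n + 1))
  have h4 : (n + 2) * ‖padeSeq t a b (n + 2)‖ ≤ (n + 2) * (‖padeSeq t a b (n + 1)‖ / 2) := by
    gcongr
    linarith
  have h5 : (2 * n + 3) * 100 * ‖padeSeq t a b (n + 1)‖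
      ≤ (2 * n + 3) * ‖t‖ * ‖padeSeq t a b (n + 1)‖ := by gcongr
  have h6 : 0 ≤ n * ‖padeSeq t a b (n + 1)‖ := by positivity
  have hz := norm_nonneg (padeSeq t a b n)
  have h7 : 0 ≤ n * ‖padeSeq t a b n‖ := by positivity
  nlinarith

lemma padeSeq_decay_lower {t : ℂ} (ht : 100 ≤ ‖t‖) (a b : ℂ)
    (hb : ∀ n, ‖padeSeq t a b n‖ ≤ 50 ^ n) (n : ℕ) :
    9 * ‖padeSeq t a b n‖ ≤ ‖t‖ * ‖padeSeq t a b (n + 1)‖ := by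
  have h1 := padeSeq_back t a b n
  have h2 := padeSeq_decay ht a b hb (n + 1)
  have h3 : 60 * (n + 1) * ‖padeSeq t a b n‖ ≤ padeCoef n * ‖padeSeq t a b n‖ := by
    gcongr
    exact le_padeCoef n
  rw [show n + 1 + 1 = n + 2 from rfl] at h2
  have hx := norm_nonneg (padeSeq t a b (n + 1))
  have h4 : (n + 2) * ‖padeSeq t a b (n + 2)‖ ≤ (n + 2) * (‖padeSeq t a b (n + 1)‖ / 2) := by
    gcongr
    linarith
  have h5 : 100 * ‖padeSeq t a b (n + 1)‖ ≤ ‖t‖ * ‖padeSeq t a b (n + 1)‖ := by gcongr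
  have h6 : 0 ≤ n * (‖t‖ * ‖padeSeq t a b (n + 1)‖) := by positivity
  have h7 : 0 ≤ ‖t‖ * ‖padeSeq t a b (n + 1)‖ := by positivity
  have h8 : (n + 2) * (‖padeSeq t a b (n + 1)‖ / 2)
      ≤ (n + 2) * (‖t‖ * ‖padeSeq t a b (n + 1)‖ / 200) := by
    refine mul_le_mul_of_nonneg_left ?_ (by positivity)
    linarith
  have hn : (0 : ℝ) < n + 1 := by positivity
  refine le_of_mul_le_mul_left ?_ hn
  nlinarith

lemma padeDen_growth {t : ℂ} (ht : 100 ≤ ‖t‖) (n : ℕ) :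
    100 * ‖padeDen t n‖ ≤ ‖padeDen t (n + 1)‖ := by
  have h0 : ‖padeSeq t 1 (2 * t) 0‖ ≤ 2 * ‖padeSeq t 1 (2 * t) 1‖ := by
    simp [padeSeq]
    linarith
  cases n with
  | zero =>
    simp [padeDen, padeSeq]
    linarith
  | succ n =>
    have h := (padeSeq_growth_iterate ht 1 (2 * t) 0 h0 n).2
    rw [zero_add] at h
    exact padeSeq_growth ht 1 (2 * t) n h

lemma padeDen_upper {t : ℂ} (ht : 100 ≤ ‖t‖) (n : ℕ) :
    (n + 2) * ‖padeDen t (n + 2)‖ ≤ 1002 / 500 * (2 * n + 3) * ‖t‖ * ‖padeDen t (n + 1)‖ := by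
  have h1 := padeSeq_upper t 1 (2 * t) n
  have h2 := padeDen_growth ht n
  change (n + 2) * ‖padeDen t (n + 2)‖ ≤
      2 * (2 * n + 3) * ‖t‖ * ‖padeDen t (n + 1)‖ + padeCoef n * ‖padeDen t n‖ at h1
  have hx := norm_nonneg (padeDen t (n + 1))
  have h3 : padeCoef n * ‖padeDen t n‖ ≤ 64 * (n + 1) * (‖padeDen t (n + 1)‖ / 100) := by
    gcongr
    · exact padeCoef_le n
    · linarith
  have h5 : (2 * n + 3) * 100 * ‖padeDen t (n + 1)‖
      ≤ (2 * n + 3) * ‖t‖ * ‖padeDen t (n + 1)‖ := by gcongr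
  have h6 : 0 ≤ n * ‖padeDen t (n + 1)‖ := by positivity
  nlinarith

/-- One step multiplies the product by at most `(1002/500) (1603/50)^3 (n+1)^3 / ((n+2) (2n+3)^2
|t|^2)`. As `(2n+3)^2 ≥ 4 (n+1)(n+2)` and `|t| ≥ 100`, this is at most `1.652 (n+1)^2 / (n+2)^2`,
which explains the weight `(n + 1)^2`. The start is `2 |t| |θ|^3 ≤ 2 (1.01)^3 / 100^2`. -/
lemma padeDen_mul_padeRem_le {t θ : ℂ} (ht : 100 ≤ ‖t‖) (hθ : ‖t‖ * ‖θ‖ ≤ 101 / 100)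
    (hb : ∀ n, ‖padeRem t θ n‖ ≤ 50 ^ n) (n : ℕ) :
    (n + 1) ^ 2 * (‖padeDen t (n + 1)‖ * ‖padeRem t θ n‖ ^ 3) ≤
      21 / 100000 * (1652 / 1000) ^ n := by
  induction n with
  | zero =>
    have h1 : ‖padeDen t 1‖ = 2 * ‖t‖ := by simp [padeDen, padeSeq]
    have h2 : ‖padeRem t θ 0‖ = ‖θ‖ := by simp [padeRem, padeNum, padeDen, padeSeq]
    simp only [CharP.cast_eq_zero, zero_add, h1, h2, pow_zero, one_pow, one_mul]
    have h3 : (‖t‖ * ‖θ‖) ^ 3 ≤ (101 / 100) ^ 3 := by gcongr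
    have h4 : (100 : ℝ) ^ 2 ≤ ‖t‖ ^ 2 := by gcongr
    have h5 : 0 ≤ 2 * ‖t‖ * ‖θ‖ ^ 3 := by positivity
    have h6 : ‖t‖ ^ 2 * (2 * ‖t‖ * ‖θ‖ ^ 3) = 2 * (‖t‖ * ‖θ‖) ^ 3 := by ring
    nlinarith
  | succ n ih =>
    have h1 := padeDen_upper ht n
    have hb' : ∀ n, ‖padeSeq t (-θ) (2 - 2 * t * θ) n‖ ≤ 50 ^ n := by
      simpa only [padeRem_eq] using hb
    have h2 := padeSeq_decay_sharp ht (-θ) (2 - 2 * t * θ) hb' n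
    simp only [← padeRem_eq] at h2
    rw [show n + 1 + 1 = n + 2 from rfl]
    set x := ‖padeDen t (n + 1)‖
    set x' := ‖padeDen t (n + 2)‖
    set y := ‖padeRem t θ n‖
    set y' := ‖padeRem t θ (n + 1)‖
    set T := ‖t‖
    have hx : 0 ≤ x := norm_nonneg _
    have hy : 0 ≤ y := norm_nonneg _
    have hx' : 0 ≤ x' := norm_nonneg _
    have hy' : 0 ≤ y' := norm_nonneg _
    have hT : 0 < T := by linarith
    have h3 : ((2 * n + 3) * T * y') ^ 3 ≤ (1603 / 50 * (n + 1) * y) ^ 3 := by gcongr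
    have h4 : ((n + 2) * x') * ((2 * n + 3) * T * y') ^ 3
        ≤ (1002 / 500 * (2 * n + 3) * T * x) * (1603 / 50 * (n + 1) * y) ^ 3 := by gcongr
    have h5 : (n + 2) * (2 * n + 3) ^ 2 * T ^ 2 * (x' * y' ^ 3)
        ≤ 1002 / 500 * (1603 / 50) ^ 3 * (n + 1) ^ 3 * (x * y ^ 3) := by
      have hp : (0 : ℝ) < (2 * n + 3) * T := by positivity
      refine le_of_mul_le_mul_left ?_ hp
      linear_combination h4
    have h6 : (n + 2) * (4 * (n + 1) * (n + 2)) * (100 : ℝ) ^ 2 * (x' * y' ^ 3)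
        ≤ (n + 2) * (2 * n + 3) ^ 2 * T ^ 2 * (x' * y' ^ 3) := by
      gcongr
      nlinarith
    have h7 : (n + 1) * (((n : ℝ) + 2) ^ 2 * (x' * y' ^ 3)) ≤
        (n + 1) * (1652 / 1000 * ((n + 1) ^ 2 * (x * y ^ 3))) := by
      have : 0 ≤ ((n : ℝ) + 1) ^ 3 * (x * y ^ 3) := by positivity
      nlinarith
    have h8 := le_of_mul_le_mul_left h7 (by positivity)
    push_cast
    rw [show (n : ℝ) + 1 + 1 = n + 2 by ring, pow_succ (1652 / 1000 : ℝ)]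
    linarith

/-- The Padé approximation of the small root of the form. -/
theorem exists_padeApproximation {t : ℂ} (ht : 100 ≤ ‖t‖) :
    ∃ θ : ℂ, θ ≠ 0 ∧ ‖t‖ * ‖θ‖ ≤ 101 / 100 ∧ t * (θ - θ ^ 3) = 1 - 6 * θ ^ 2 + θ ^ 4 ∧
      (∀ n, 2 * ‖padeRem t θ (n + 1)‖ ≤ ‖padeRem t θ n‖) ∧
      (∀ n, 9 * ‖padeRem t θ n‖ ≤ ‖t‖ * ‖padeRem t θ (n + 1)‖) ∧
      (∀ n, padeRem t θ n ≠ 0) ∧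
      ∀ n : ℕ, (n + 1) ^ 2 * (‖padeDen t (n + 1)‖ * ‖padeRem t θ n‖ ^ 3) ≤
        21 / 100000 * (1652 / 1000) ^ n := by
  obtain ⟨θ, h0, h1, h2, h3⟩ := exists_small_root ht
  have h3' : ∀ n, ‖padeSeq t (-θ) (2 - 2 * t * θ) n‖ ≤ 50 ^ n := by
    simpa only [padeRem_eq] using h3
  have h4 := padeSeq_decay_lower ht _ _ h3'
  simp only [← padeRem_eq] at h4
  refine ⟨θ, h0, h1, h2, fun n => ?_, h4, fun n => ?_, padeDen_mul_padeRem_le ht h1 h3⟩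
  · simpa only [padeRem_eq] using padeSeq_decay ht _ _ h3' n
  · induction n with
    | zero => simpa [padeRem, padeNum, padeDen, padeSeq] using h0
    | succ n ih =>
      intro h
      have := h4 n
      rw [h, norm_zero, mul_zero] at this
      have := norm_pos_iff.mpr ih
      linarith

end

/-! ### Hypergeometric form of the approximants and their integrality -/

section

open Complex Finset

/-- `(n + j)! / (n - j)!`, with value `0` for `n < j`. -/
def padePhi (n j : ℕ) : ℕ := (n + j).descFactorial (2 * j)

lemma padePhi_zero (n : ℕ) : padePhi n 0 = 1 := by simp [padePhi]

lemma padePhi_eq_zero {n j : ℕ} (h : n < j) : padePhi n j = 0 := by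
  rw [padePhi, Nat.descFactorial_eq_zero_iff_lt]
  omega

lemma padePhi_succ_left (n j : ℕ) :
    (padePhi (n + 2) (j + 1) : ℂ) = (n + j + 3) * (n + j + 2) * padePhi (n + 1) j := by
  have h : padePhi (n + 2) (j + 1) = (n + j + 3) * ((n + j + 2) * padePhi (n + 1) j) := by
    rw [padePhi, padePhi, show n + 2 + (j + 1) = (n + 1 + j) + 1 + 1 by ring,
      show 2 * (j + 1) = 2 * j + 1 + 1 by ring, Nat.succ_descFactorial_succ,
      Nat.succ_descFactorial_succ]
    ring
  rw [h]
  push_cast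
  ring

lemma descFactorial_succ_cast (a k : ℕ) :
    (a.descFactorial (k + 1) : ℂ) = (a - k) * a.descFactorial k := by
  rcases le_or_gt k a with h | h
  · rw [Nat.descFactorial_succ]
    push_cast [h]
    ring
  · rw [Nat.descFactorial_eq_zero_iff_lt.mpr h, Nat.descFactorial_eq_zero_iff_lt.mpr (by omega)]
    simp

lemma padePhi_succ_mid (n j : ℕ) :
    (padePhi (n + 1) (j + 1) : ℂ) = (n + j + 2) * (n + 1 - j) * padePhi (n + 1) j := by
  rw [padePhi, padePhi, show n + 1 + (j + 1) = (n + 1 + j) + 1 by ring,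
    show 2 * (j + 1) = 2 * j + 1 + 1 by ring, Nat.succ_descFactorial_succ]
  push_cast
  rw [descFactorial_succ_cast]
  push_cast
  ring

lemma padePhi_succ_right (n j : ℕ) :
    (padePhi n (j + 1) : ℂ) = (n + 1 - j) * (n - j) * padePhi (n + 1) j := by
  rw [padePhi, padePhi, show n + (j + 1) = n + 1 + j by ring,
    show 2 * (j + 1) = 2 * j + 1 + 1 by ring, descFactorial_succ_cast, descFactorial_succ_cast]
  push_cast
  ring

/-- The product `5 * 9 * ⋯ * (4 n + 1)`. -/
def padePi (n : ℕ) : ℕ := ∏ i ∈ range n, (4 * i + 5)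

lemma padePi_ne_zero (n : ℕ) : (padePi n : ℂ) ≠ 0 := by
  have : padePi n ≠ 0 := Finset.prod_ne_zero_iff.mpr fun i _ => by omega
  exact_mod_cast this

lemma padePi_succ (n : ℕ) : (padePi (n + 1) : ℂ) = padePi n * (4 * n + 5) := by
  rw [padePi, Finset.prod_range_succ, ← padePi]
  push_cast
  rfl

/-- The part of the coefficients depending on the exponent only. -/
noncomputable def padeB (j : ℕ) : ℂ := (-1 / 2) ^ j / (j.factorial * padePi j)

lemma padeB_succ (j : ℕ) : padeB (j + 1) * (2 * (j + 1) * (4 * j + 5)) = - padeB j := by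
  have h1 := padePi_ne_zero j
  have h2 : (j.factorial : ℂ) ≠ 0 := by exact_mod_cast j.factorial_ne_zero
  have h3 : ((j : ℂ) + 1) ≠ 0 := by exact_mod_cast (by omega : j + 1 ≠ 0)
  have h4 : (4 * (j : ℂ) + 5) ≠ 0 := by exact_mod_cast (by omega : 4 * j + 5 ≠ 0)
  rw [padeB, padeB, padePi_succ, Nat.factorial_succ, pow_succ]
  push_cast
  rw [div_mul_eq_mul_div, ← neg_div, div_eq_div_iff (by positivity) (by positivity)]
  ring

/-- The part of the coefficients depending on the degree only. -/
noncomputable def padeC (n : ℕ) : ℂ := (-2) ^ n * padePi n / n.factorial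

lemma padeC_succ (n : ℕ) : (n + 1) * padeC (n + 1) = -2 * (4 * n + 5) * padeC n := by
  have h2 : (n.factorial : ℂ) ≠ 0 := by exact_mod_cast n.factorial_ne_zero
  have h3 : ((n : ℂ) + 1) ≠ 0 := by exact_mod_cast (by omega : n + 1 ≠ 0)
  rw [padeC, padeC, padePi_succ, Nat.factorial_succ, pow_succ]
  push_cast
  field_simp

/-- The hypergeometric polynomial, up to normalisation. -/
noncomputable def padeS (Y : ℂ) (n : ℕ) : ℂ := ∑ j ∈ range (n + 1), padePhi n j * padeB j * Y ^ j

lemma padeS_eq (Y : ℂ) {n M : ℕ} (h : n + 1 ≤ M) :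
    padeS Y n = ∑ j ∈ range M, padePhi n j * padeB j * Y ^ j := by
  refine Finset.sum_subset (by simpa using h) fun j _ hj => ?_
  rw [padePhi_eq_zero (by simpa using hj)]
  simp

/-- `padeS Y n` is the Jacobi-type polynomial `₂F₁(-n, n + 1; 5/4; Y/8)`, and this is its contiguous
relation. The three shifted values of `padePhi` are multiples of `padePhi (n + 1) j`, so each
coefficient reduces to one polynomial identity. -/
lemma padeS_rec (Y : ℂ) (n : ℕ) :
    (4 * n + 9) * padeS Y (n + 2) = -(2 * n + 3) * (Y - 4) * padeS Y (n + 1)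
      - (4 * n + 3) * padeS Y n := by
  have h : (4 * n + 9) * padeS Y (n + 2) - 4 * (2 * n + 3) * padeS Y (n + 1)
      + (4 * n + 3) * padeS Y n = -(2 * n + 3) * Y * padeS Y (n + 1) := by
    rw [padeS_eq Y (show n + 1 + 1 ≤ n + 2 + 1 by omega),
      padeS_eq Y (show n + 1 ≤ n + 2 + 1 by omega), padeS, mul_sum, mul_sum, mul_sum,
      ← sum_sub_distrib, ← sum_add_distrib, Finset.sum_range_succ']
    simp only [padePhi_zero]
    have e0 : (4 * n + 9) * (((1 : ℕ) : ℂ) * padeB 0 * Y ^ 0)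
        - 4 * (2 * n + 3) * (((1 : ℕ) : ℂ) * padeB 0 * Y ^ 0)
        + (4 * n + 3) * (((1 : ℕ) : ℂ) * padeB 0 * Y ^ 0) = 0 := by
      push_cast
      ring
    rw [e0, add_zero, ← padeS_eq Y (show n + 1 + 1 ≤ n + 2 + 1 by omega), padeS, mul_sum]
    refine Finset.sum_congr rfl fun j _ => ?_
    rw [padePhi_succ_left, padePhi_succ_mid, padePhi_succ_right, pow_succ]
    linear_combination (2 * n + 3) * padePhi (n + 1) j * Y ^ j * Y * padeB_succ j
  linear_combination h

/-- The Padé numerator of the fourth root, in the variable `T`. -/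
noncomputable def padeP (T : ℂ) (n : ℕ) : ℂ := padeC n * padeS (T + 4) n

lemma padeP_rec (T : ℂ) (n : ℕ) :
    (n + 2) * padeP T (n + 2) = 2 * (2 * n + 3) * T * padeP T (n + 1)
      - 4 * (16 * (n + 1) ^ 2 - 1) / (n + 1) * padeP T n := by
  have h := padeS_rec (T + 4) n
  have h1 := padeC_succ (n + 1)
  have h0 := padeC_succ n
  push_cast at h1
  have hn : ((n : ℂ) + 1) ≠ 0 := by exact_mod_cast (by omega : n + 1 ≠ 0)
  simp only [padeP]
  have e : 4 * (16 * ((n : ℂ) + 1) ^ 2 - 1) / (n + 1) * (padeC n * padeS (T + 4) n)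
      = - 2 * (4 * n + 3) * padeC (n + 1) * padeS (T + 4) n := by
    rw [div_mul_eq_mul_div, div_eq_iff hn]
    linear_combination 2 * (4 * n + 3) * padeS (T + 4) n * h0
  rw [e]
  linear_combination padeS (T + 4) (n + 2) * h1 - 2 * padeC (n + 1) * h

lemma padeP_zero (T : ℂ) : padeP T 0 = 1 := by
  simp [padeP, padeC, padeS, padeB, padePhi, padePi]

lemma padeP_one (T : ℂ) : padeP T 1 = 2 * T - 2 := by
  simp [padeP, padeC, padeS, padeB, padePhi, padePi, Finset.sum_range_succ, Nat.descFactorial]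
  ring

/-- The left side is `q_n + ε p_n`. Taking `ε = i` and `ε = -i` recovers `p_n` and `q_n` as the
parts of fixed parity of one polynomial on the imaginary axis. -/
lemma padeSeq_eq_padeP {ε : ℂ} (hε : ε ^ 2 = -1) (t : ℂ) (n : ℕ) :
    padeSeq t 1 (2 * t + 2 * ε) n = (-ε) ^ n * padeP (ε * t) n := by
  have h := eq_padeSeq t (fun n => (-ε) ^ n * padeP (ε * t) n) (fun n => ?_) n
  · rw [h, padeP_zero, padeP_one]
    congr 1
    · simp
    · linear_combination 2 * t * hε
  · have h := padeP_rec (ε * t) n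
    rw [pow_succ _ (n + 1), pow_succ]
    linear_combination (-ε) ^ n * (-ε) * (-ε) * h
      - (-ε) ^ n * (-2 * (2 * n + 3) * t * ε * padeP (ε * t) (n + 1)
        + 4 * (16 * (n + 1) ^ 2 - 1) / (n + 1) * padeP (ε * t) n) * hε

lemma padeSeq_combination (t a b a' b' c d : ℂ) (n : ℕ) :
    c * padeSeq t a b n + d * padeSeq t a' b' n = padeSeq t (c * a + d * a') (c * b + d * b') n := by
  refine eq_padeSeq t (fun n => c * padeSeq t a b n + d * padeSeq t a' b' n) (fun n => ?_) n
  linear_combination c * padeSeq_rec t a b n + d * padeSeq_rec t a' b' n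

lemma padeDen_eq (t : ℂ) (n : ℕ) :
    2 * padeDen t n = (-I) ^ n * (padeP (I * t) n + (-1) ^ n * padeP (I * -t) n) := by
  have e : (-I) ^ n * (-1) ^ n = (- -I) ^ n := by rw [← mul_pow]; simp
  have h1 := padeSeq_combination t 1 (2 * t + 2 * I) 1 (2 * t + 2 * -I) 1 1 n
  have h2 := padeSeq_combination t 1 (2 * t) 1 (2 * t) 1 1 n
  rw [mul_add, ← mul_assoc, e, show I * -t = -I * t by ring, ← padeSeq_eq_padeP I_sq,
    ← padeSeq_eq_padeP (ε := -I) (by rw [neg_sq, I_sq])]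
  rw [show 1 * (2 * t + 2 * I) + 1 * (2 * t + 2 * -I) = 1 * (2 * t) + 1 * (2 * t) by ring,
    ← h2] at h1
  rw [padeDen]
  linear_combination -h1

lemma padeNum_eq (t : ℂ) (n : ℕ) :
    2 * padeNum t n = -I * (-I) ^ n * (padeP (I * t) n + (-1) ^ (n + 1) * padeP (I * -t) n) := by
  have e : (-I) ^ n * (-1) ^ n = (- -I) ^ n := by rw [← mul_pow]; simp
  have h1 := padeSeq_combination t 1 (2 * t + 2 * I) 1 (2 * t + 2 * -I) (-I) I n
  have h2 := padeSeq_combination t 0 2 0 2 1 1 n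
  have e' : -I * (-I) ^ n * (padeP (I * t) n + (-1) ^ (n + 1) * padeP (I * -t) n)
      = -I * ((-I) ^ n * padeP (I * t) n - (- -I) ^ n * padeP (-I * t) n) := by
    rw [← e, show I * -t = -I * t by ring]
    ring
  rw [e', ← padeSeq_eq_padeP I_sq, ← padeSeq_eq_padeP (ε := -I) (by rw [neg_sq, I_sq])]
  rw [show -I * (2 * t + 2 * I) + I * (2 * t + 2 * -I) = 1 * 2 + 1 * 2 by
      linear_combination -4 * I_sq,
    show -I * 1 + I * 1 = 1 * 0 + 1 * 0 by ring, ← h2] at h1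
  rw [padeNum]
  linear_combination -h1

/-- The part of parity `n` of an integer polynomial, evaluated on the imaginary axis. -/
lemma exists_parity_part (p : Polynomial ℤ) (n : ℕ) :
    ∃ q : Polynomial ℤ, ∀ t : ℂ, Polynomial.aeval (I * t) p
      + (-1) ^ n * Polynomial.aeval (I * -t) p = 2 * I ^ n * Polynomial.aeval t q := by
  induction p using Polynomial.induction_on' with
  | add p p' hp hp' =>
    obtain ⟨q, hq⟩ := hp
    obtain ⟨q', hq'⟩ := hp'
    refine ⟨q + q', fun t => ?_⟩
    simp only [map_add]
    linear_combination hq t + hq' t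
  | monomial j a =>
    rcases Nat.even_or_odd (n + j) with he | ho
    -- The exponent `j + 3n` replaces `j - n`, to which it is congruent modulo `4`, so that `i^j =
    -- i^n (-1)^m` needs no subtraction.
    · obtain ⟨m, hm⟩ : Even (j + 3 * n) := by
        rw [Nat.even_add] at he ⊢
        rw [Nat.even_mul]
        have : ¬ Even 3 := by decide
        tauto
      refine ⟨Polynomial.monomial j ((-1) ^ m * a), fun t => ?_⟩
      have h1 : I ^ j = I ^ n * (-1) ^ m := by
        have h4 : I ^ (4 * n) = 1 := by
          rw [pow_mul, show 4 = 2 * 2 from rfl, pow_mul, I_sq]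
          norm_num
        rw [← I_sq, ← pow_mul, two_mul, ← hm, ← pow_add, ← mul_one (I ^ j), ← h4, ← pow_add]
        congr 1
        ring
      have h2 : (-1 : ℂ) ^ n * (-1) ^ j = 1 := by rw [← pow_add, he.neg_one_pow]
      simp only [Polynomial.aeval_monomial]
      rw [mul_pow, mul_pow, neg_pow t, h1]
      simp
      linear_combination (a : ℂ) * I ^ n * (-1) ^ m * t ^ j * h2
    · refine ⟨0, fun t => ?_⟩
      have h2 : (-1 : ℂ) ^ n * (-1) ^ j = -1 := by rw [← pow_add, ho.neg_one_pow]
      simp only [Polynomial.aeval_monomial]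
      rw [mul_pow, mul_pow, neg_pow t]
      simp
      linear_combination (a : ℂ) * I ^ j * t ^ j * h2

lemma padeP_coeff {n j : ℕ} (h : j ≤ n) :
    padeC n * (padePhi n j * padeB j) * (n - j).factorial =
      (-2) ^ (n - j) * (n + j).choose j * ∏ i ∈ Ico j n, ((4 * i + 5 : ℕ) : ℂ) := by
  have h1 : (padePhi n j : ℂ) * (n - j).factorial = (n + j).factorial := by
    have := Nat.factorial_mul_descFactorial (show 2 * j ≤ n + j by omega)
    rw [show n + j - 2 * j = n - j by omega] at this
    rw [padePhi, mul_comm]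
    exact_mod_cast this
  have h2 : ((n + j).choose j : ℂ) * j.factorial * n.factorial = (n + j).factorial := by
    have := Nat.choose_mul_factorial_mul_factorial (show j ≤ n + j by omega)
    rw [Nat.add_sub_cancel] at this
    exact_mod_cast this
  have h3 : (padePi j : ℂ) * ∏ i ∈ Ico j n, ((4 * i + 5 : ℕ) : ℂ) = padePi n := by
    have := Finset.prod_range_mul_prod_Ico (fun i => 4 * i + 5) h
    rw [← padePi, ← padePi] at this
    exact_mod_cast this
  have h4 : (-2 : ℂ) ^ n * (-1 / 2) ^ j = (-2) ^ (n - j) := by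
    obtain ⟨k, rfl⟩ := Nat.exists_eq_add_of_le h
    rw [Nat.add_sub_cancel_left, pow_add, mul_right_comm, ← mul_pow]
    norm_num
  have h5 := padePi_ne_zero j
  have h6 : (j.factorial : ℂ) ≠ 0 := by exact_mod_cast j.factorial_ne_zero
  have h7 : (n.factorial : ℂ) ≠ 0 := by exact_mod_cast n.factorial_ne_zero
  rw [padeC, padeB, ← h3, ← h4]
  field_simp
  linear_combination (∏ i ∈ Ico j n, ((4 * i + 5 : ℕ) : ℂ)) * (h1 - h2)

/-- A common divisor of the coefficients of the Padé approximants. -/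
def IsPadeContent (n G : ℕ) : Prop :=
  ∀ j ≤ n, (n - j).factorial * G ∣ 2 ^ (n - j) * (n + j).choose j * ∏ i ∈ Ico j n, (4 * i + 5)

lemma IsPadeContent.exists_padeP {n G : ℕ} (h : IsPadeContent n G) :
    ∃ p : Polynomial ℤ, ∀ T : ℂ, padeP T n = G * Polynomial.aeval T p := by
  choose! e he using h
  refine ⟨∑ j ∈ range (n + 1), Polynomial.C ((-1) ^ (n - j) * (e j : ℤ))
    * (Polynomial.X + 4) ^ j, fun T => ?_⟩
  rw [padeP, padeS, mul_sum, map_sum, mul_sum]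
  refine Finset.sum_congr rfl fun j hj => ?_
  have hj' : j ≤ n := by simpa [Nat.lt_succ_iff] using hj
  have h0 : ((n - j).factorial : ℂ) ≠ 0 := by exact_mod_cast (n - j).factorial_ne_zero
  have h1 := padeP_coeff hj'
  have h2 : ((2 : ℂ) ^ (n - j) * (n + j).choose j * ∏ i ∈ Ico j n, ((4 * i + 5 : ℕ) : ℂ))
      = (n - j).factorial * G * e j := by exact_mod_cast he j hj'
  apply mul_left_cancel₀ h0
  rw [show (-2 : ℂ) = -1 * 2 by norm_num, mul_pow] at h1
  simp only [map_mul, map_pow, map_add, Polynomial.aeval_X, map_neg, map_one,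
    map_ofNat, map_natCast]
  linear_combination (T + 4) ^ j * h1 + (-1) ^ (n - j) * (T + 4) ^ j * h2

/-- The factor `2` in `padeNum_eq` and `padeDen_eq` cancels the one produced by the parity part, so
the full content `G` survives. -/
theorem IsPadeContent.exists_pade {n G : ℕ} (h : IsPadeContent n G) :
    ∃ p q : Polynomial ℤ, ∀ t : ℂ, padeNum t n = G * Polynomial.aeval t p ∧
      padeDen t n = G * Polynomial.aeval t q := by
  obtain ⟨r, hr⟩ := h.exists_padeP
  obtain ⟨p, hp⟩ := exists_parity_part r (n + 1)
  obtain ⟨q, hq⟩ := exists_parity_part r n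
  refine ⟨p, q, fun t => ⟨?_, ?_⟩⟩
  · have h1 := padeNum_eq t n
    have e : (-I) ^ n * I ^ n = 1 := by rw [← mul_pow]; simp
    rw [hr, hr] at h1
    have h2 := hp t
    rw [pow_succ I] at h2
    linear_combination h1 / 2 - I * (-I) ^ n * G / 2 * h2
      - I ^ 2 * G * Polynomial.aeval t p * e - G * Polynomial.aeval t p * I_sq
  · have h1 := padeDen_eq t n
    have e : (-I) ^ n * I ^ n = 1 := by rw [← mul_pow]; simp
    rw [hr, hr] at h1
    linear_combination h1 / 2 + (-I) ^ n * G / 2 * hq t + G * Polynomial.aeval t q * e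

end

section

open Finset

/-! ### Divisibility of the coefficients -/

lemma exists_residue {q : ℕ} (hq : Odd q) : ∃ a, 4 * a + 1 = q ∨ 4 * a + 1 = 3 * q := by
  obtain ⟨k, rfl⟩ := hq
  rcases Nat.even_or_odd' k with ⟨l, rfl | rfl⟩
  · exact ⟨l, Or.inl (by ring)⟩
  -- Here `q = 4l + 3`, and `4 (3l + 2) + 1 = 3 q`.
  · exact ⟨3 * l + 2, Or.inr (by ring)⟩

lemma le_card_of_progression {q j n m c : ℕ} (hq : 0 < q) (hm : j < m) (hdvd : q ∣ 4 * m + 1)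
    (hc : m + q * c ≤ n + q) : c ≤ #{i ∈ Ico j n | q ∣ 4 * i + 5} := by
  have h : Set.InjOn (fun k => m - 1 + q * k) (range c) := by
    intro a _ b _ hab
    exact Nat.eq_of_mul_eq_mul_left hq (Nat.add_left_cancel hab)
  rw [← card_range c, ← card_image_of_injOn h]
  refine card_le_card fun i hi => ?_
  obtain ⟨k, hk, rfl⟩ := mem_image.mp hi
  have hk' : k + 1 ≤ c := mem_range.mp hk
  have h2 : q * k + q ≤ q * c := by
    calc q * k + q = q * (k + 1) := by ring
      _ ≤ q * c := Nat.mul_le_mul_left q hk'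
  rw [mem_filter, mem_Ico]
  refine ⟨⟨by omega, by omega⟩, ?_⟩
  have : 4 * (m - 1 + q * k) + 5 = (4 * m + 1) + q * (4 * k) := by
    obtain ⟨l, rfl⟩ : ∃ l, m = l + 1 := ⟨m - 1, by omega⟩
    rw [Nat.add_sub_cancel]
    ring
  rw [this]
  exact (Nat.dvd_add_right hdvd).mpr (dvd_mul_right _ _)

/-- Put `m = i + 1`: the condition `q ∣ 4m + 1` selects one residue class `a` modulo `q`, with `a <
3q/4`, and `m` runs over `(j, n]`. Every `q` consecutive values contain one hit. If `n % q ≥ 3q/4`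
and adding `j` to `n` produces no carry at `q`, then `j % q < a ≤ n % q` and there is an extra hit.
The carry is what the binomial coefficient contributes by Kummer's theorem. -/
lemma residue_count {q : ℕ} (hq : Odd q) {j n : ℕ} (hjn : j ≤ n) :
    (n - j) / q + (if 3 * q ≤ 4 * (n % q) then 1 else 0) ≤
      (if q ≤ j % q + n % q then 1 else 0) + #{i ∈ Ico j n | q ∣ 4 * i + 5} := by
  have hq0 : 0 < q := hq.pos
  obtain ⟨a, ha⟩ := exists_residue hq
  have hdvd : ∀ k, q ∣ 4 * (q * k + a) + 1 := by
    intro k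
    rw [show 4 * (q * k + a) + 1 = q * (4 * k) + (4 * a + 1) by ring]
    refine dvd_add (dvd_mul_right _ _) ?_
    rcases ha with h | h
    · rw [h]
    · rw [h]; exact dvd_mul_left _ _
  have hj := Nat.div_add_mod j q
  have hn := Nat.div_add_mod n q
  have hjq := Nat.mod_lt j hq0
  have hnq := Nat.mod_lt n hq0
  by_cases hcase : 3 * q ≤ 4 * (n % q) ∧ ¬ q ≤ j % q + n % q
  · obtain ⟨h1, h2⟩ := hcase
    rw [if_pos h1, if_neg h2, zero_add]
    have hJ : j / q ≤ n / q := Nat.div_le_div_right hjn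
    obtain ⟨d, hd⟩ := Nat.exists_eq_add_of_le hJ
    have hmul : q * (n / q) = q * (j / q) + q * d := by rw [hd]; ring
    have hdiv : (n - j) / q = d := by
      rw [Nat.div_eq_iff hq0]
      constructor
      · rw [mul_comm d q]
        omega
      · rw [mul_comm d q]
        omega
    have hodd : 3 * q ≠ 4 * (n % q) := by
      intro h
      obtain ⟨k, rfl⟩ := hq
      omega
    rw [hdiv]
    refine le_card_of_progression hq0 (m := q * (j / q) + a) ?_ (hdvd _) ?_
    · omega
    · rw [mul_add, mul_one]
      omega
  · have hle : (n - j) / q ≤ #{i ∈ Ico j n | q ∣ 4 * i + 5} := by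
      have hdm := Nat.div_mul_le_self (n - j) q
      rw [mul_comm] at hdm
      by_cases h : j % q < a
      · refine le_card_of_progression hq0 (m := q * (j / q) + a) ?_ (hdvd _) ?_ <;> omega
      · refine le_card_of_progression hq0 (m := q * (j / q + 1) + a) ?_ (hdvd _) ?_ <;>
        · rw [mul_add, mul_one]
          omega
    split_ifs <;> omega

lemma factorization_prod_progression {p : ℕ} (hp : p.Prime) {j n b : ℕ} (hb : 4 * n + 5 < b) :
    (∏ i ∈ Ico j n, (4 * i + 5)).factorization p
      = ∑ e ∈ Ico 1 b, #{i ∈ Ico j n | p ^ e ∣ 4 * i + 5} := by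
  rw [Nat.factorization_prod_apply (fun i _ => by omega)]
  simp only [card_filter]
  rw [sum_comm]
  refine sum_congr rfl fun i hi => ?_
  rw [mem_Ico] at hi
  rw [Nat.factorization_eq_card_pow_dvd_of_lt hp (by omega : 0 < 4 * i + 5) (b := b), card_filter]
  exact (by omega : 4 * i + 5 < b).trans (Nat.lt_pow_self hp.one_lt)

/-- At odd primes, summing `residue_count` over prime powers compares Legendre's formula for `(n -
j)!` with Kummer's for the binomial and the count for the product. At `2` the power `2 ^ (n - j)`
just absorbs the factorial, so `G` has to be odd. -/
lemma isPadeContent_of_factorization {n G b : ℕ} (hG : G ≠ 0) (hb : 4 * n + 5 < b)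
    (h2 : G.factorization 2 = 0)
    (h : ∀ p : ℕ, p.Prime → p ≠ 2 →
      G.factorization p ≤ ∑ e ∈ Ico 1 b, if 3 * p ^ e ≤ 4 * (n % p ^ e) then 1 else 0) :
    IsPadeContent n G := by
  intro j hj
  have hprod : ∏ i ∈ Ico j n, (4 * i + 5) ≠ 0 := prod_ne_zero_iff.mpr fun i _ => by omega
  have hch : (n + j).choose j ≠ 0 := (Nat.choose_pos (by omega)).ne'
  rw [← Nat.factorization_prime_le_iff_dvd (mul_ne_zero (Nat.factorial_ne_zero _) hG)
    (mul_ne_zero (mul_ne_zero (by positivity) hch) hprod)]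
  intro p hp
  rw [Nat.factorization_mul (Nat.factorial_ne_zero _) hG,
    Nat.factorization_mul (mul_ne_zero (by positivity) hch) hprod,
    Nat.factorization_mul (by positivity) hch]
  simp only [Finsupp.add_apply]
  rcases eq_or_ne p 2 with rfl | hp2
  · have h3 := Nat.factorization_factorial_le_div_pred Nat.prime_two (n - j)
    rw [h2, Nat.prime_two.factorization_pow]
    simp at h3 ⊢
    omega
  · have hlog : ∀ x, x < b → Nat.log p x < b := fun x hx => (Nat.log_le_self p x).trans_lt hx
    rw [Nat.factorization_factorial hp (hlog (n - j) (by omega)),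
      Nat.factorization_choose' hp (hlog (n + j) (by omega)),
      factorization_prod_progression hp hb, card_filter]
    refine le_trans (add_le_add_right (h p hp hp2) _) ?_
    rw [← sum_add_distrib, add_assoc, ← sum_add_distrib]
    refine le_trans (sum_le_sum fun e _ => residue_count ((hp.odd_of_ne_two hp2).pow) hj) ?_
    exact Nat.le_add_left _ _

/-! ### An explicit content -/

/-- The numerator of a quotient of factorials whose odd part divides the coefficients. -/
def contentNum (n : ℕ) : ℕ := (4 * n / 3).factorial * (n / 3).factorial

/-- The denominator of a quotient of factorials whose odd part divides the coefficients. -/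
def contentDen (n : ℕ) : ℕ := n.factorial * (2 * n / 3).factorial

/-- The reduced numerator of `contentNum n / contentDen n`. -/
def contentQuot (n : ℕ) : ℕ := contentNum n / (contentNum n).gcd (contentDen n)

/-- An explicit common divisor of the coefficients of the Padé approximants. -/
def padeContent (n : ℕ) : ℕ := ordCompl[2] (contentQuot n)

lemma contentNum_ne_zero (n : ℕ) : contentNum n ≠ 0 :=
  mul_ne_zero (Nat.factorial_ne_zero _) (Nat.factorial_ne_zero _)

lemma contentDen_ne_zero (n : ℕ) : contentDen n ≠ 0 :=
  mul_ne_zero (Nat.factorial_ne_zero _) (Nat.factorial_ne_zero _)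

lemma contentQuot_mul_gcd (n : ℕ) :
    contentQuot n * (contentNum n).gcd (contentDen n) = contentNum n :=
  Nat.div_mul_cancel (Nat.gcd_dvd_left _ _)

lemma contentQuot_ne_zero (n : ℕ) : contentQuot n ≠ 0 := by
  intro h
  have := contentQuot_mul_gcd n
  rw [h, zero_mul] at this
  exact contentNum_ne_zero n this.symm

lemma padeContent_pos (n : ℕ) : 0 < padeContent n := Nat.ordCompl_pos 2 (contentQuot_ne_zero n)

/-- A Chebyshev-type device: it bounds the factorial quotient by the wanted prime powers. All floors
depend only on `N = ⌊4n/q⌋`, and the claim becomes `⌊N/3⌋ + ⌊N/12⌋ ≤ [N ≡ 3 mod 4] + ⌊N/4⌋ + ⌊N/6⌋`,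
a check modulo `12`. -/
lemma floor_inequality (n q : ℕ) (hq : 0 < q) :
    4 * n / 3 / q + n / 3 / q ≤
      (if 3 * q ≤ 4 * (n % q) then 1 else 0) + (n / q + 2 * n / 3 / q) := by
  have e1 : 4 * n / 3 / q = 4 * n / q / 3 := Nat.div_right_comm _ _ _
  have e2 : n / 3 / q = 4 * n / q / 12 := by
    rw [Nat.div_right_comm, Nat.div_div_eq_div_mul (4 * n), mul_comm q 12,
      show 12 * q = 4 * (3 * q) by ring, Nat.mul_div_mul_left _ _ (by norm_num), mul_comm 3 q,
      Nat.div_div_eq_div_mul]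
  have e3 : 2 * n / 3 / q = 4 * n / q / 6 := by
    rw [Nat.div_right_comm, Nat.div_div_eq_div_mul (4 * n), mul_comm q 6,
      show 6 * q = 2 * (3 * q) by ring, show 4 * n = 2 * (2 * n) by ring,
      Nat.mul_div_mul_left _ _ (by norm_num), mul_comm 3 q, Nat.div_div_eq_div_mul]
  have e4 : n / q = 4 * n / q / 4 := by
    rw [Nat.div_div_eq_div_mul, mul_comm q 4, Nat.mul_div_mul_left _ _ (by norm_num)]
  have e5 : 4 * n / q % 4 = 3 → 3 * q ≤ 4 * (n % q) := by
    intro h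
    have h1 : 4 * n / q = 4 * (n / q) + 4 * (n % q) / q := by
      conv_lhs => rw [← Nat.div_add_mod n q]
      rw [mul_add, show 4 * (q * (n / q)) = q * (4 * (n / q)) by ring, Nat.mul_add_div hq]
    have h2 : 3 ≤ 4 * (n % q) / q := by omega
    exact (Nat.le_div_iff_mul_le hq).mp h2
  rw [e1, e2, e3]
  rw [e4]
  generalize 4 * n / q = N at *
  split_ifs with h
  · omega
  · have : N % 4 ≠ 3 := fun h' => h (e5 h')
    omega

lemma factorization_contentQuot_le {n p b : ℕ} (hp : p.Prime) (hb : 4 * n + 5 < b) :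
    (contentQuot n).factorization p
      ≤ ∑ e ∈ Ico 1 b, if 3 * p ^ e ≤ 4 * (n % p ^ e) then 1 else 0 := by
  have hlog : ∀ x, x < b → Nat.log p x < b := fun x hx => (Nat.log_le_self p x).trans_lt hx
  have h1 : (contentNum n).factorization p
      ≤ (∑ e ∈ Ico 1 b, if 3 * p ^ e ≤ 4 * (n % p ^ e) then 1 else 0)
        + (contentDen n).factorization p := by
    rw [contentNum, contentDen, Nat.factorization_mul (Nat.factorial_ne_zero _)
      (Nat.factorial_ne_zero _), Nat.factorization_mul (Nat.factorial_ne_zero _)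
      (Nat.factorial_ne_zero _)]
    simp only [Finsupp.add_apply]
    rw [Nat.factorization_factorial hp (hlog _ (by omega)),
      Nat.factorization_factorial hp (hlog _ (by omega)),
      Nat.factorization_factorial hp (hlog _ (by omega)),
      Nat.factorization_factorial hp (hlog _ (by omega)), ← sum_add_distrib, ← sum_add_distrib,
      ← sum_add_distrib]
    exact sum_le_sum fun e _ => floor_inequality n _ (pow_pos hp.pos e)
  rw [contentQuot, Nat.factorization_div (Nat.gcd_dvd_left _ _),
    Nat.factorization_gcd (contentNum_ne_zero n) (contentDen_ne_zero n)]
  simp only [Finsupp.tsub_apply, Finsupp.inf_apply]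
  omega

theorem isPadeContent_padeContent (n : ℕ) : IsPadeContent n (padeContent n) := by
  refine isPadeContent_of_factorization (b := 4 * n + 6) (padeContent_pos n).ne' (by omega) ?_ ?_
  · rw [padeContent, Nat.factorization_ordCompl]
    simp
  · intro p hp hp2
    rw [padeContent, Nat.factorization_ordCompl, Finsupp.erase_ne hp2]
    exact factorization_contentQuot_le hp (by omega)

/-- Making the content odd costs only a factor linear in `n`. The exponent `1` never counts, and the
largest counted `L` satisfies `3 * 2 ^ L ≤ 4 n`; so at most `L - 1` exponents count. -/
lemma two_pow_card_le {n : ℕ} (hn : 2 ≤ n) (b : ℕ) :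
    3 * 2 ^ (∑ e ∈ Ico 1 b, if 3 * 2 ^ e ≤ 4 * (n % 2 ^ e) then 1 else 0) ≤ 2 * n := by
  rw [← card_filter]
  set S := {e ∈ Ico 1 b | 3 * 2 ^ e ≤ 4 * (n % 2 ^ e)} with hS
  rcases S.eq_empty_or_nonempty with h | h
  · rw [h]
    simp
    omega
  · have hmem := S.max'_mem h
    set L := S.max' h
    have hsub : S ⊆ Ico 2 (L + 1) := by
      intro e he
      have h1 := S.le_max' e he
      rw [hS, mem_filter, mem_Ico] at he
      rw [mem_Ico]
      refine ⟨?_, by omega⟩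
      by_contra hlt
      obtain rfl : e = 1 := by omega
      have := Nat.mod_lt n (by norm_num : 0 < 2)
      omega
    have hcard : #S + 1 ≤ L := by
      have := card_le_card hsub
      rw [Nat.card_Ico] at this
      have h2 := mem_Ico.mp (hsub hmem)
      omega
    have hpow : 2 ^ (#S + 1) ≤ 2 ^ L := Nat.pow_le_pow_right (by norm_num) hcard
    rw [hS, mem_filter] at hmem
    have := Nat.mod_le n (2 ^ L)
    rw [pow_succ] at hpow
    omega

lemma contentNum_le {n : ℕ} (hn : 2 ≤ n) :
    3 * contentNum n ≤ 2 * n * padeContent n * contentDen n := by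
  have h1 := Nat.ordProj_mul_ordCompl_eq_self (contentQuot n) 2
  rw [← padeContent] at h1
  have h2 := factorization_contentQuot_le (n := n) Nat.prime_two (b := 4 * n + 6) (by omega)
  have h3 : 2 ^ (contentQuot n).factorization 2 ≤ 2 ^ (∑ e ∈ Ico 1 (4 * n + 6),
      if 3 * 2 ^ e ≤ 4 * (n % 2 ^ e) then 1 else 0) := Nat.pow_le_pow_right (by norm_num) h2
  have h4 := two_pow_card_le hn (4 * n + 6)
  have h5 : 3 * 2 ^ (contentQuot n).factorization 2 ≤ 2 * n := by omega
  have h6 : (contentNum n).gcd (contentDen n) ≤ contentDen n :=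
    Nat.le_of_dvd (Nat.pos_of_ne_zero (contentDen_ne_zero n)) (Nat.gcd_dvd_right _ _)
  calc 3 * contentNum n = 3 * (contentQuot n * (contentNum n).gcd (contentDen n)) := by
        rw [contentQuot_mul_gcd]
    _ = 3 * 2 ^ (contentQuot n).factorization 2 * padeContent n
        * (contentNum n).gcd (contentDen n) := by rw [mul_assoc 3 (2 ^ _), h1, mul_assoc]
    _ ≤ 2 * n * padeContent n * contentDen n := by gcongr

end

/-! ### Exponential lower bound for the content -/

lemma factorial_ratio_lower (m : ℕ) :
    2 * (23 / 10 : ℝ) ^ m * ((3 * (m + 1)).factorial * (2 * (m + 1)).factorial) ≤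
      (4 * (m + 1)).factorial * (m + 1).factorial := by
  induction m with
  | zero => norm_num [Nat.factorial]
  | succ m ih =>
    have h4 : ((4 * (m + 1 + 1)).factorial : ℝ) = (4 * m + 8) * (4 * m + 7) * (4 * m + 6)
        * (4 * m + 5) * (4 * (m + 1)).factorial := by
      rw [show 4 * (m + 1 + 1) = 4 * (m + 1) + 1 + 1 + 1 + 1 by ring]
      simp only [Nat.factorial_succ (4 * (m + 1) + 1 + 1 + 1),
        Nat.factorial_succ (4 * (m + 1) + 1 + 1),
        Nat.factorial_succ (4 * (m + 1) + 1),
        Nat.factorial_succ (4 * (m + 1))]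
      push_cast
      ring
    have h3 : ((3 * (m + 1 + 1)).factorial : ℝ) = (3 * m + 6) * (3 * m + 5) * (3 * m + 4)
        * (3 * (m + 1)).factorial := by
      rw [show 3 * (m + 1 + 1) = 3 * (m + 1) + 1 + 1 + 1 by ring]
      simp only [Nat.factorial_succ (3 * (m + 1) + 1 + 1),
        Nat.factorial_succ (3 * (m + 1) + 1),
        Nat.factorial_succ (3 * (m + 1))]
      push_cast
      ring
    have h2 : ((2 * (m + 1 + 1)).factorial : ℝ) = (2 * m + 4) * (2 * m + 3)
        * (2 * (m + 1)).factorial := by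
      rw [show 2 * (m + 1 + 1) = 2 * (m + 1) + 1 + 1 by ring]
      simp only [Nat.factorial_succ (2 * (m + 1) + 1),
        Nat.factorial_succ (2 * (m + 1))]
      push_cast
      ring
    have h1 : ((m + 1 + 1).factorial : ℝ) = (m + 2) * (m + 1).factorial := by
      rw [Nat.factorial_succ]
      push_cast
      ring
    rw [h4, h3, h2, h1]
    -- The ratio of consecutive terms tends to `4^4 / (3^3 * 2^2) = 64/27`, slightly above `2.3`.
    have hp : (23 / 10 : ℝ) * ((3 * m + 6) * (3 * m + 5) * (3 * m + 4) * ((2 * m + 4) * (2 * m + 3)))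
        ≤ (4 * m + 8) * (4 * m + 7) * (4 * m + 6) * (4 * m + 5) * (m + 2) := by
      have hm : (0 : ℝ) ≤ m := m.cast_nonneg
      have e : (4 * m + 8) * (4 * m + 7) * (4 * m + 6) * (4 * m + 5) * (m + 2)
          - (23 / 10 : ℝ) * ((3 * m + 6) * (3 * m + 5) * (3 * m + 4) * ((2 * m + 4) * (2 * m + 3)))
          = (m + 2) ^ 2 * (2 * m + 3) * (4 * (4 * m + 7) * (4 * m + 5) * 2
            - (23 / 10) * 6 * (3 * m + 5) * (3 * m + 4)) := by ring
      have e2 : (0 : ℝ) ≤ 4 * (4 * m + 7) * (4 * m + 5) * 2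
            - (23 / 10) * 6 * (3 * m + 5) * (3 * m + 4) := by nlinarith
      have : (0 : ℝ) ≤ (m + 2) ^ 2 * (2 * m + 3) * (4 * (4 * m + 7) * (4 * m + 5) * 2
            - (23 / 10) * 6 * (3 * m + 5) * (3 * m + 4)) := by positivity
      linarith
    calc 2 * (23 / 10 : ℝ) ^ (m + 1) * ((3 * m + 6) * (3 * m + 5) * (3 * m + 4)
          * (3 * (m + 1)).factorial * ((2 * m + 4) * (2 * m + 3) * (2 * (m + 1)).factorial))
        = (23 / 10 : ℝ) * ((3 * m + 6) * (3 * m + 5) * (3 * m + 4) * ((2 * m + 4) * (2 * m + 3)))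
          * (2 * (23 / 10 : ℝ) ^ m
            * ((3 * (m + 1)).factorial * (2 * (m + 1)).factorial)) := by ring
      _ ≤ (4 * m + 8) * (4 * m + 7) * (4 * m + 6) * (4 * m + 5) * (m + 2)
          * ((4 * (m + 1)).factorial * (m + 1).factorial) := by gcongr
      _ = _ := by ring

/-- The rational factor is the exact correction for `n % 3 = 2`; the other two residues satisfy the
same bound with room to spare. -/
lemma contentNum_lower (n : ℕ) (hn : 3 ≤ n) :
    4 * (23 / 10 : ℝ) ^ (n / 3 - 1) * (4 * (n / 3 : ℕ) + 1) * contentDen n ≤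
      (3 * (n / 3 : ℕ) + 2) * (3 * (n / 3 : ℕ) + 1) * contentNum n := by
  obtain ⟨m, hm⟩ : ∃ m, n / 3 = m + 1 := ⟨n / 3 - 1, by omega⟩
  have h := factorial_ratio_lower m
  rw [hm, Nat.add_sub_cancel]
  have hr : n % 3 = 0 ∨ n % 3 = 1 ∨ n % 3 = 2 := by omega
  set X : ℝ := (23 / 10 : ℝ) ^ m with hX
  have hX0 : 0 < X := by positivity
  push_cast
  rcases hr with hr | hr | hr
  · rw [contentNum, contentDen, hm, show 4 * n / 3 = 4 * (m + 1) by omega,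
      show 2 * n / 3 = 2 * (m + 1) by omega, show n = 3 * (m + 1) by omega]
    push_cast
    set a : ℝ := ((4 * (m + 1)).factorial : ℝ)
    set b : ℝ := ((3 * (m + 1)).factorial : ℝ)
    set c : ℝ := ((2 * (m + 1)).factorial : ℝ)
    set d : ℝ := ((m + 1).factorial : ℝ)
    have hbc : 0 ≤ 2 * X * (b * c) := by positivity
    calc 4 * X * (4 * (m + 1) + 1) * (b * c) = 2 * (4 * (m + 1) + 1) * (2 * X * (b * c)) := by ring
      _ ≤ (3 * (m + 1) + 2) * (3 * (m + 1) + 1) * (2 * X * (b * c)) := by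
        refine mul_le_mul_of_nonneg_right ?_ hbc
        nlinarith [Nat.cast_nonneg (α := ℝ) m]
      _ ≤ _ := by gcongr
  · rw [contentNum, contentDen, hm, show 4 * n / 3 = 4 * (m + 1) + 1 by omega,
      show 2 * n / 3 = 2 * (m + 1) by omega, show n = 3 * (m + 1) + 1 by omega,
      Nat.factorial_succ (4 * (m + 1)), Nat.factorial_succ (3 * (m + 1))]
    push_cast
    set a : ℝ := ((4 * (m + 1)).factorial : ℝ)
    set b : ℝ := ((3 * (m + 1)).factorial : ℝ)
    set c : ℝ := ((2 * (m + 1)).factorial : ℝ)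
    set d : ℝ := ((m + 1).factorial : ℝ)
    have hbc : 0 ≤ 2 * X * (b * c) := by positivity
    calc 4 * X * (4 * (m + 1) + 1) * ((3 * (m + 1) + 1) * b * c)
        = 2 * ((3 * (m + 1) + 1) * (4 * (m + 1) + 1)) * (2 * X * (b * c)) := by ring
      _ ≤ (3 * (m + 1) + 2) * ((3 * (m + 1) + 1) * (4 * (m + 1) + 1)) * (2 * X * (b * c)) := by
        gcongr
        nlinarith [Nat.cast_nonneg (α := ℝ) m]
      _ ≤ (3 * (m + 1) + 2) * ((3 * (m + 1) + 1) * (4 * (m + 1) + 1)) * (a * d) := by gcongr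
      _ = _ := by ring
  · rw [contentNum, contentDen, hm, show 4 * n / 3 = 4 * (m + 1) + 1 + 1 by omega,
      show 2 * n / 3 = 2 * (m + 1) + 1 by omega, show n = 3 * (m + 1) + 1 + 1 by omega,
      Nat.factorial_succ (4 * (m + 1) + 1), Nat.factorial_succ (4 * (m + 1)),
      Nat.factorial_succ (3 * (m + 1) + 1), Nat.factorial_succ (3 * (m + 1)),
      Nat.factorial_succ (2 * (m + 1))]
    push_cast
    set a : ℝ := ((4 * (m + 1)).factorial : ℝ)
    set b : ℝ := ((3 * (m + 1)).factorial : ℝ)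
    set c : ℝ := ((2 * (m + 1)).factorial : ℝ)
    set d : ℝ := ((m + 1).factorial : ℝ)
    have hbc : 0 ≤ 2 * X * (b * c) := by positivity
    calc 4 * X * (4 * (m + 1) + 1) * ((3 * (m + 1) + 1 + 1) * ((3 * (m + 1) + 1) * b)
          * ((2 * (m + 1) + 1) * c))
        = (3 * (m + 1) + 2) * (3 * (m + 1) + 1) * (4 * (m + 1) + 1) * (2 * (2 * (m + 1) + 1))
          * (2 * X * (b * c)) := by ring
      _ ≤ (3 * (m + 1) + 2) * (3 * (m + 1) + 1) * (4 * (m + 1) + 1) * (2 * (2 * (m + 1) + 1))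
          * (a * d) := by gcongr
      _ = _ := by ring

lemma polynomial_step (m : ℝ) (hm : 0 ≤ m) :
    2124 / 1000 * ((4 * m + 13) ^ 2 * (3 * m + 14) ^ 4 * (3 * m + 13)) ≤
      529 / 100 * ((4 * m + 17) ^ 2 * (3 * m + 11) ^ 4 * (3 * m + 10)) := by
  rw [← sub_nonneg]
  ring_nf
  positivity

lemma exponential_lower (m : ℕ) :
    102 / 1000 * (2124 / 1000 : ℝ) ^ (m + 3) * ((3 * m + 11) ^ 4 * (3 * m + 10)) ≤
      36 * (529 / 100 : ℝ) ^ (m + 2) * (4 * m + 13) ^ 2 := by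
  induction m with
  | zero => norm_num
  | succ m ih =>
    have h := polynomial_step m m.cast_nonneg
    push_cast
    have hp : (0 : ℝ) < (3 * m + 11) ^ 4 * (3 * m + 10) := by positivity
    refine le_of_mul_le_mul_left ?_ hp
    calc ((3 * (m : ℝ) + 11) ^ 4 * (3 * m + 10)) * (102 / 1000 * (2124 / 1000 : ℝ) ^ (m + 1 + 3)
          * ((3 * (m + 1) + 11) ^ 4 * (3 * (m + 1) + 10)))
        = (102 / 1000 * (2124 / 1000 : ℝ) ^ (m + 3) * ((3 * m + 11) ^ 4 * (3 * m + 10)))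
          * (2124 / 1000 * ((3 * m + 14) ^ 4 * (3 * m + 13))) := by ring
      _ ≤ (36 * (529 / 100 : ℝ) ^ (m + 2) * (4 * m + 13) ^ 2)
          * (2124 / 1000 * ((3 * m + 14) ^ 4 * (3 * m + 13))) := by gcongr
      _ = 36 * (529 / 100 : ℝ) ^ (m + 2)
          * (2124 / 1000 * ((4 * m + 13) ^ 2 * (3 * m + 14) ^ 4 * (3 * m + 13))) := by ring
      _ ≤ 36 * (529 / 100 : ℝ) ^ (m + 2)
          * (529 / 100 * ((4 * m + 17) ^ 2 * (3 * m + 11) ^ 4 * (3 * m + 10))) := by gcongr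
      _ = _ := by ring

/-- The base `1.652` is the growth rate allowed in `padeDen_mul_padeRem_le`. The content's fourth
power grows like `2.3 ^ (4n/3)`, about `3.03 ^ n`, which leaves room for all polynomial losses. The
rate `2.124` exceeds `1.652 ^ (3/2)`, since squares of the bound are taken over blocks of three. -/
theorem padeContent_lower (n : ℕ) :
    38 / 10000 * (1652 / 1000 : ℝ) ^ n ≤ (n + 1) ^ 2 * (padeContent n : ℝ) ^ 4 := by
  have hG : (1 : ℝ) ≤ padeContent n := by exact_mod_cast padeContent_pos n
  rcases lt_or_ge n 9 with hn | hn
  -- For small `n` the trivial bound `padeContent n ≥ 1` is enough.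
  · have h1 : (1652 / 1000 : ℝ) ^ n ≤ (1652 / 1000) ^ 8 :=
      pow_le_pow_right₀ (by norm_num) (by omega)
    have h2 : (1 : ℝ) ≤ (padeContent n : ℝ) ^ 4 := one_le_pow₀ hG
    have h3 : (1 : ℝ) ≤ ((n : ℝ) + 1) ^ 2 := one_le_pow₀ (by linarith [n.cast_nonneg (α := ℝ)])
    have h4 : (38 / 10000 * (1652 / 1000) ^ 8 : ℝ) ≤ 1 := by norm_num
    nlinarith
  · obtain ⟨m, hm⟩ : ∃ m, n / 3 = m + 3 := ⟨n / 3 - 3, by omega⟩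
    have hden : (0 : ℝ) < contentDen n := by exact_mod_cast Nat.pos_of_ne_zero (contentDen_ne_zero n)
    have h1 : 3 * (contentNum n : ℝ) ≤ 2 * n * padeContent n * contentDen n := by
      exact_mod_cast contentNum_le (n := n) (by omega)
    have h2 := contentNum_lower n (by omega)
    rw [hm, show m + 3 - 1 = m + 2 by omega] at h2
    push_cast at h2
    have hnu : (n : ℝ) ≤ 3 * m + 11 := by exact_mod_cast (by omega : n ≤ 3 * m + 11)
    have hnl : (3 * m + 10 : ℝ) ≤ n + 1 := by exact_mod_cast (by omega : 3 * m + 10 ≤ n + 1)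
    have h3 : 6 * (23 / 10 : ℝ) ^ (m + 2) * (4 * m + 13) ≤
        (3 * m + 11) ^ 2 * (3 * m + 10) * padeContent n := by
      refine le_of_mul_le_mul_right ?_ hden
      have h4 : (3 * (m : ℝ) + 11) * (3 * m + 10) * (3 * contentNum n) ≤
          (3 * m + 11) * (3 * m + 10) * (2 * (3 * m + 11) * padeContent n * contentDen n) := by
        refine mul_le_mul_of_nonneg_left (h1.trans ?_) (by positivity)
        gcongr
      have e1 : 6 * (23 / 10 : ℝ) ^ (m + 2) * (4 * m + 13) * contentDen n
        = 3 / 2 * (4 * (23 / 10 : ℝ) ^ (m + 2) * (4 * (m + 3) + 1) * contentDen n) := by ring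
      rw [e1]
      nlinarith
    have h5 : 102 / 1000 * (2124 / 1000 : ℝ) ^ (m + 3) ≤
        (3 * m + 10) * (padeContent n : ℝ) ^ 2 := by
      have hp : (0 : ℝ) < (3 * m + 11) ^ 4 * (3 * m + 10) := by positivity
      refine le_of_mul_le_mul_right ?_ hp
      calc 102 / 1000 * (2124 / 1000 : ℝ) ^ (m + 3) * ((3 * m + 11) ^ 4 * (3 * m + 10))
          ≤ 36 * (529 / 100 : ℝ) ^ (m + 2) * (4 * m + 13) ^ 2 := exponential_lower m
        _ = (6 * (23 / 10 : ℝ) ^ (m + 2) * (4 * m + 13)) ^ 2 := by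
          rw [mul_pow, mul_pow, ← pow_mul, mul_comm (m + 2) 2, pow_mul]
          norm_num
        _ ≤ ((3 * m + 11) ^ 2 * (3 * m + 10) * padeContent n) ^ 2 := by gcongr
        _ = _ := by ring
    calc 38 / 10000 * (1652 / 1000 : ℝ) ^ n
        ≤ 38 / 10000 * (1652 / 1000 : ℝ) ^ (3 * (m + 3) + 2) := by
          gcongr
          · norm_num
          · omega
      _ = 38 / 10000 * (1652 / 1000 : ℝ) ^ 2 * ((1652 / 1000 : ℝ) ^ 3) ^ (m + 3) := by
          rw [← pow_mul]
          ring
      _ ≤ (102 / 1000) ^ 2 * ((2124 / 1000 : ℝ) ^ 2) ^ (m + 3) := by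
          gcongr
          · norm_num
          · norm_num
      _ = (102 / 1000 * (2124 / 1000 : ℝ) ^ (m + 3)) ^ 2 := by
          rw [mul_pow, ← pow_mul, ← pow_mul, mul_comm 2]
      _ ≤ ((3 * m + 10) * (padeContent n : ℝ) ^ 2) ^ 2 := by gcongr
      _ = (3 * m + 10) ^ 2 * (padeContent n : ℝ) ^ 4 := by ring
      _ ≤ _ := by gcongr

/-! ### Imaginary quadratic fields -/

lemma imagQuad_form {d : ℕ} {z : ℂ} (hz : z ∈ imagQuadField d) :
    ∃ a b : ℚ, z = a + b * (((Real.sqrt (d : ℝ) : ℝ) : ℂ) * Complex.I) := by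
  set s : ℂ := ((Real.sqrt (d : ℝ) : ℝ) : ℂ) * Complex.I with hs
  have hs2 : s ^ 2 = -(d : ℂ) := by
    rw [hs, mul_pow, Complex.I_sq, ← Complex.ofReal_pow, Real.sq_sqrt (by positivity)]
    simp
  rw [imagQuadField] at hz
  induction hz using IntermediateField.adjoin_induction with
  | mem x hx =>
    obtain rfl : x = s := hx
    exact ⟨0, 1, by simp⟩
  | algebraMap x => exact ⟨x, 0, by simp⟩
  | add x y _ _ hx hy =>
    obtain ⟨a, b, rfl⟩ := hx
    obtain ⟨a', b', rfl⟩ := hy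
    exact ⟨a + a', b + b', by push_cast; ring⟩
  | inv x _ hx =>
    obtain ⟨a, b, rfl⟩ := hx
    rcases eq_or_ne ((a : ℂ) + b * s) 0 with h0 | h0
    · exact ⟨0, 0, by rw [h0]; simp⟩
    · refine ⟨a / (a ^ 2 + d * b ^ 2), -b / (a ^ 2 + d * b ^ 2), ?_⟩
      have h1 : ((a : ℂ) + b * s) * (a - b * s) = a ^ 2 + d * b ^ 2 := by
        linear_combination -(b : ℂ) ^ 2 * hs2
      have h2 : ((a : ℂ) ^ 2 + d * b ^ 2) ≠ 0 := by
        intro h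
        have h3 : (a ^ 2 + d * b ^ 2 : ℚ) = 0 := by exact_mod_cast h
        have ha : a = 0 := by
          have : (0 : ℚ) ≤ d * b ^ 2 := by positivity
          nlinarith [sq_nonneg a]
        rw [ha] at h3
        have h4 : (d : ℂ) * (b : ℂ) ^ 2 = 0 := by
          have : (d : ℚ) * b ^ 2 = 0 := by simpa using h3
          exact_mod_cast this
        have h5 : ((b : ℂ) * s) ^ 2 = 0 := by
          linear_combination (b : ℂ) ^ 2 * hs2 - h4
        apply h0
        rw [ha, pow_eq_zero_iff (by norm_num) |>.mp h5]
        simp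
      apply inv_eq_of_mul_eq_one_right
      push_cast
      rw [show ((a : ℂ) + b * s) * (a / (a ^ 2 + d * b ^ 2) + -b / (a ^ 2 + d * b ^ 2) * s)
        = ((a + b * s) * (a - b * s)) / (a ^ 2 + d * b ^ 2) by ring, h1, div_self h2]
  | mul x y _ _ hx hy =>
    obtain ⟨a, b, rfl⟩ := hx
    obtain ⟨a', b', rfl⟩ := hy
    refine ⟨a * a' - d * (b * b'), a * b' + a' * b, ?_⟩
    push_cast
    linear_combination (b : ℂ) * b' * hs2

lemma exists_int_of_isIntegral {a : ℚ} (h : IsIntegral ℤ (a : ℂ)) : ∃ k : ℤ, (a : ℂ) = k := by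
  have h1 : IsIntegral ℤ a := by
    have : (a : ℂ) = algebraMap ℚ ℂ a := rfl
    rw [this] at h
    exact (isIntegral_algebraMap_iff (algebraMap ℚ ℂ).injective).mp h
  obtain ⟨k, hk⟩ := IsIntegrallyClosed.isIntegral_iff.mp h1
  exact ⟨k, by rw [← hk]; simp⟩

/-- Trace and norm of an algebraic integer of an imaginary quadratic field. -/
lemma exists_trace_norm {d : ℕ} (x : 𝓞 (imagQuadField d)) :
    ∃ m k : ℤ, ((x : imagQuadField d) : ℂ) + (starRingEnd ℂ) ((x : imagQuadField d) : ℂ) = m ∧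
      ((x : imagQuadField d) : ℂ) * (starRingEnd ℂ) ((x : imagQuadField d) : ℂ) = k := by
  set z : ℂ := ((x : imagQuadField d) : ℂ) with hz
  have hzi : IsIntegral ℤ z := by
    have h := x.2
    have h1 : IsIntegral ℤ (x : imagQuadField d) := h
    exact h1.map (IsScalarTower.toAlgHom ℤ (imagQuadField d) ℂ)
  have hci : IsIntegral ℤ ((starRingEnd ℂ) z) :=
    hzi.map ((starRingEnd ℂ).toIntAlgHom)
  obtain ⟨a, b, hab⟩ := imagQuad_form (x : imagQuadField d).2
  rw [← hz] at hab
  have hc : (starRingEnd ℂ) z = a - b * (((Real.sqrt (d : ℝ) : ℝ) : ℂ) * Complex.I) := by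
    rw [hab]
    simp only [map_add, map_mul, Complex.conj_ofReal, Complex.conj_I, map_ratCast]
    ring
  have hs2 : ((Real.sqrt (d : ℝ) : ℝ) : ℂ) ^ 2 = d := by
    rw [← Complex.ofReal_pow, Real.sq_sqrt (by positivity)]
    simp
  obtain ⟨m, hm⟩ := exists_int_of_isIntegral (a := 2 * a) (by
    have : ((2 * a : ℚ) : ℂ) = z + (starRingEnd ℂ) z := by
      rw [hc, hab]
      push_cast
      ring
    rw [this]
    exact hzi.add hci)
  obtain ⟨k, hk⟩ := exists_int_of_isIntegral (a := a ^ 2 + d * b ^ 2) (by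
    have : ((a ^ 2 + d * b ^ 2 : ℚ) : ℂ) = z * (starRingEnd ℂ) z := by
      rw [hc, hab]
      push_cast
      linear_combination (b : ℂ) ^ 2 * ((Real.sqrt (d : ℝ) : ℝ) : ℂ) ^ 2 * Complex.I_sq
        - (b : ℂ) ^ 2 * hs2
    rw [this]
    exact hzi.mul hci)
  refine ⟨m, k, ?_, ?_⟩
  · rw [← hm, hc, hab]
    push_cast
    ring
  · rw [← hk, hc, hab]
    push_cast
    linear_combination -(b : ℂ) ^ 2 * ((Real.sqrt (d : ℝ) : ℝ) : ℂ) ^ 2 * Complex.I_sq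
        + (b : ℂ) ^ 2 * hs2

lemma one_le_imagQuadAbs {d : ℕ} {x : 𝓞 (imagQuadField d)} (hx : x ≠ 0) : 1 ≤ imagQuadAbs x := by
  obtain ⟨m, k, -, hk⟩ := exists_trace_norm x
  rw [Complex.mul_conj, Complex.normSq_eq_norm_sq] at hk
  have hk' : imagQuadAbs x ^ 2 = k := by
    rw [imagQuadAbs]
    exact_mod_cast hk
  have hpos : 0 < imagQuadAbs x := by
    rw [imagQuadAbs, norm_pos_iff]
    simpa using hx
  have hk0 : (0 : ℝ) < k := by rw [← hk']; positivity
  have hk1 : (1 : ℝ) ≤ k := by exact_mod_cast Int.cast_pos.mp hk0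
  rw [← hk'] at hk1
  nlinarith

lemma isUnityRoot_of_abs_eq_one {d : ℕ} {x : 𝓞 (imagQuadField d)} (hx : imagQuadAbs x = 1) :
    IsUnityRoot x := by
  obtain ⟨m, k, hm, hk⟩ := exists_trace_norm x
  set z : ℂ := ((x : imagQuadField d) : ℂ) with hz
  have hn : ‖z‖ = 1 := hx
  have hzz : z * (starRingEnd ℂ) z = 1 := by
    rw [Complex.mul_conj, Complex.normSq_eq_norm_sq, hn]
    simp
  have hq : z ^ 2 = m * z - 1 := by linear_combination z * hm - hzz
  have hm2 : |(m : ℝ)| ≤ 2 := by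
    have h1 : ‖(m : ℂ)‖ ≤ 2 := by
      rw [← hm]
      refine (norm_add_le _ _).trans ?_
      rw [RCLike.norm_conj, hn]
      norm_num
    simpa using h1
  have hm3 : |m| ≤ 2 := by exact_mod_cast hm2
  rw [abs_le] at hm3
  -- The trace is an integer in `[-2, 2]`, so `z` has order `1`, `2`, `3`, `4` or `6`.
  have hz12 : z ^ 12 = 1 := by
    obtain ⟨h1, h2⟩ := hm3
    interval_cases m
    · have : (z + 1) ^ 2 = 0 := by push_cast at hq; linear_combination hq
      have : z = -1 := by linear_combination pow_eq_zero_iff (by norm_num) |>.mp this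
      rw [this]; norm_num
    · have h3 : z ^ 3 = 1 := by push_cast at hq; linear_combination (z - 1) * hq
      rw [show 12 = 3 * 4 from rfl, pow_mul, h3, one_pow]
    · have h3 : z ^ 2 = -1 := by push_cast at hq; linear_combination hq
      rw [show 12 = 2 * 6 from rfl, pow_mul, h3]; norm_num
    · have h3 : z ^ 3 = -1 := by push_cast at hq; linear_combination (z + 1) * hq
      rw [show 12 = 3 * 4 from rfl, pow_mul, h3]; norm_num
    · have : (z - 1) ^ 2 = 0 := by push_cast at hq; linear_combination hq
      have : z = 1 := by linear_combination pow_eq_zero_iff (by norm_num) |>.mp this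
      rw [this]; norm_num
  refine ⟨12, by norm_num, ?_⟩
  apply NumberField.RingOfIntegers.ext
  apply Subtype.ext
  simpa using hz12

/-- The inclusion of the ring of integers in the complex numbers. -/
noncomputable def imagQuadEmb (d : ℕ) : 𝓞 (imagQuadField d) →+* ℂ :=
  (algebraMap (imagQuadField d) ℂ).comp (algebraMap (𝓞 (imagQuadField d)) (imagQuadField d))

lemma norm_imagQuadEmb {d : ℕ} (x : 𝓞 (imagQuadField d)) : ‖imagQuadEmb d x‖ = imagQuadAbs x := rfl

lemma one_le_norm_imagQuadEmb {d : ℕ} {x : 𝓞 (imagQuadField d)} (hx : x ≠ 0) :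
    1 ≤ ‖imagQuadEmb d x‖ := one_le_imagQuadAbs hx

lemma imagQuadEmb_simplestQuartic {d : ℕ} (t x y : 𝓞 (imagQuadField d)) :
    imagQuadEmb d (simplestQuartic t x y) =
      simplestQuartic (imagQuadEmb d t) (imagQuadEmb d x) (imagQuadEmb d y) := by
  have h6 : imagQuadEmb d 6 = 6 := map_ofNat (imagQuadEmb d) 6
  simp only [simplestQuartic, map_add, map_sub, map_mul, map_pow, h6]

lemma imagQuadAbs_neg_four_mul {d : ℕ} (z : 𝓞 (imagQuadField d)) :
    imagQuadAbs (-4 * z) = 4 * imagQuadAbs z := by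
  rw [show -4 * z = -(z + z + z + z) by ring, ← norm_imagQuadEmb, ← norm_imagQuadEmb, map_neg,
    norm_neg, map_add, map_add, map_add, show imagQuadEmb d z + imagQuadEmb d z + imagQuadEmb d z
      + imagQuadEmb d z = 4 * imagQuadEmb d z by ring, norm_mul]
  norm_num

/-- The linear forms built from the Padé approximants are divisible by the content. -/
lemma exists_linearForm {d : ℕ} (t x y : 𝓞 (imagQuadField d)) (n : ℕ) :
    ∃ a : 𝓞 (imagQuadField d), padeNum (imagQuadEmb d t) n * imagQuadEmb d x
      - padeDen (imagQuadEmb d t) n * imagQuadEmb d y = padeContent n * imagQuadEmb d a := by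
  obtain ⟨p, q, h⟩ := (isPadeContent_padeContent n).exists_pade
  obtain ⟨hp, hq⟩ := h (imagQuadEmb d t)
  have ha : ∀ r : Polynomial ℤ, Polynomial.aeval (imagQuadEmb d t) r
      = imagQuadEmb d (Polynomial.aeval t r) := fun r =>
    Polynomial.aeval_algHom_apply (imagQuadEmb d).toIntAlgHom t r
  refine ⟨Polynomial.aeval t p * x - Polynomial.aeval t q * y, ?_⟩
  rw [hp, hq, ha, ha, map_sub, map_mul, map_mul]
  ring

/-! ### Linear forms and the contradiction for solutions close to the small root -/

lemma linearForm_eq (t θ x y : ℂ) (n : ℕ) :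
    padeNum t n * x - padeDen t n * y = x * padeRem t θ n + padeDen t n * (x * θ - y) := by
  rw [padeRem]
  ring

/-- The quartic estimate for an index where the linear form vanishes. -/
lemma estimate_of_vanishing {T X R R' Q e g : ℝ} (hX : 0 < X) (hR : 0 ≤ R)
    (hQ : 0 ≤ Q) (hg : 1 ≤ g) (he : e * (T * X ^ 3) ≤ 10) (h0 : X * R' = Q * e)
    (hRR : 9 * R ≤ T * R') (hgR : g ≤ 2 * (X * R)) (hM : 380 * (Q * R ^ 3) ≤ 21 * g ^ 4) :
    False := by
  have h1 : X ^ 4 * (9 * R) ≤ X ^ 4 * (T * R') := by gcongr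
  have h2 : X ^ 4 * (T * R') = Q * (e * (T * X ^ 3)) := by
    linear_combination T * X ^ 3 * h0
  have h3 : Q * (e * (T * X ^ 3)) ≤ Q * 10 := by gcongr
  have h4 : R ^ 3 * (X ^ 4 * (9 * R)) ≤ R ^ 3 * (Q * 10) := by
    refine mul_le_mul_of_nonneg_left ?_ (by positivity)
    linarith
  have h5 : g ^ 4 ≤ (2 * (X * R)) ^ 4 := by gcongr
  have h6 : (1 : ℝ) ≤ g ^ 4 := one_le_pow₀ hg
  nlinarith

/-- The quartic estimate for an index where the linear form does not vanish. -/
lemma estimate_of_ne_zero {T X R R' Q e g G : ℝ} (hT : 100 ≤ T) (hX : 0 < X) (hR : 0 ≤ R)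
    (hQ : 0 ≤ Q) (hg : 1 ≤ g) (hG : 1 ≤ G) (he : e * (T * X ^ 3) ≤ 10)
    (h0 : G ≤ X * R' + Q * e) (hGR : 2 * (X * R') < G) (hgR : g ≤ 2 * (X * R))
    (hM : 380 * (Q * R ^ 3) ≤ 21 * g ^ 4) (hM' : Q * R ^ 3 ≤ 1 / 4 * G ^ 4) : False := by
  have h1 : G ≤ 2 * (Q * e) := by linarith
  have h2 : R ^ 3 * (T * X ^ 3) * G ≤ R ^ 3 * (T * X ^ 3) * (2 * (Q * e)) := by gcongr
  have h3 : (R ^ 3 * Q) * (e * (T * X ^ 3)) ≤ (R ^ 3 * Q) * 10 := by gcongr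
  have h4 : g ^ 3 ≤ (2 * (X * R)) ^ 3 := by gcongr
  have h5 : T * G * g ^ 3 ≤ T * G * (2 * (X * R)) ^ 3 := by gcongr
  have h6 : T * (G * g ^ 3) ≤ 160 * (Q * R ^ 3) := by linarith
  have h7 : 100 * (G * g ^ 3) ≤ T * (G * g ^ 3) := by gcongr
  set M := Q * R ^ 3
  have h8 : G * g ^ 3 ≤ 8 / 5 * M := by linarith
  have hM0 : 0 < M := by
    have : 0 < G * g ^ 3 := by positivity
    linarith
  have h9 : (G * g ^ 3) ^ 4 ≤ (8 / 5 * M) ^ 4 := by gcongr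
  have h10 : (4 * M) * (380 / 21 * M) ^ 3 ≤ G ^ 4 * (g ^ 4) ^ 3 := by
    gcongr
    · linarith
    · linarith
  have h11 : 0 < M ^ 4 := by positivity
  nlinarith

/-- A solution close to the small root is trivial. -/
lemma eq_zero_of_close {d : ℕ} {t x y : 𝓞 (imagQuadField d)} {θ : ℂ}
    (ht : 100 ≤ ‖imagQuadEmb d t‖) (hx : x ≠ 0)
    (hdec : ∀ n, 2 * ‖padeRem (imagQuadEmb d t) θ (n + 1)‖ ≤ ‖padeRem (imagQuadEmb d t) θ n‖)
    (hback : ∀ n, 9 * ‖padeRem (imagQuadEmb d t) θ n‖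
      ≤ ‖imagQuadEmb d t‖ * ‖padeRem (imagQuadEmb d t) θ (n + 1)‖)
    (hprod : ∀ n : ℕ, (n + 1) ^ 2 * (‖padeDen (imagQuadEmb d t) (n + 1)‖
      * ‖padeRem (imagQuadEmb d t) θ n‖ ^ 3) ≤ 21 / 100000 * (1652 / 1000) ^ n)
    (hclose : ‖imagQuadEmb d x * θ - imagQuadEmb d y‖
      * (‖imagQuadEmb d t‖ * ‖imagQuadEmb d x‖ ^ 3) ≤ 10) : y = 0 := by
  by_contra hy
  have hX1 := one_le_norm_imagQuadEmb hx
  have hX0 : 0 < ‖imagQuadEmb d x‖ := by linarith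
  -- The remainders at least halve at each step while the content is at least `1`.
  have hex : ∃ n, 2 * (‖imagQuadEmb d x‖ * ‖padeRem (imagQuadEmb d t) θ n‖) < padeContent n := by
    have hgeo : ∀ n, 2 ^ n * ‖padeRem (imagQuadEmb d t) θ n‖ ≤ ‖padeRem (imagQuadEmb d t) θ 0‖ := by
      intro n
      induction n with
      | zero => simp
      | succ n ih =>
        refine le_trans ?_ ih
        rw [pow_succ, mul_assoc]
        gcongr
        exact hdec n
    obtain ⟨n, hn⟩ := pow_unbounded_of_one_lt
      (2 * (‖imagQuadEmb d x‖ * ‖padeRem (imagQuadEmb d t) θ 0‖)) (one_lt_two (α := ℝ))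
    refine ⟨n, ?_⟩
    have h1 : (1 : ℝ) ≤ padeContent n := by exact_mod_cast padeContent_pos n
    refine lt_of_lt_of_le ?_ h1
    have h2 : (0 : ℝ) < 2 ^ n := by positivity
    refine lt_of_mul_lt_mul_left ?_ h2.le
    calc 2 ^ n * (2 * (‖imagQuadEmb d x‖ * ‖padeRem (imagQuadEmb d t) θ n‖))
        = 2 * (‖imagQuadEmb d x‖ * (2 ^ n * ‖padeRem (imagQuadEmb d t) θ n‖)) := by ring
      _ ≤ 2 * (‖imagQuadEmb d x‖ * ‖padeRem (imagQuadEmb d t) θ 0‖) := by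
        gcongr
        exact hgeo n
      _ < 2 ^ n * 1 := by rwa [mul_one]
  classical
  obtain ⟨n, hn, hmin⟩ : ∃ n, 2 * (‖imagQuadEmb d x‖ * ‖padeRem (imagQuadEmb d t) θ n‖)
      < padeContent n ∧ ∀ m < n, ¬ 2 * (‖imagQuadEmb d x‖ * ‖padeRem (imagQuadEmb d t) θ m‖)
      < padeContent m := ⟨Nat.find hex, Nat.find_spec hex, fun m hm => Nat.find_min hex hm⟩
  obtain ⟨a, ha⟩ := exists_linearForm t x y n
  rw [linearForm_eq _ θ] at ha
  have hG : (1 : ℝ) ≤ padeContent n := by exact_mod_cast padeContent_pos n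
  have hlow : a ≠ 0 → (padeContent n : ℝ) ≤ ‖imagQuadEmb d x‖ * ‖padeRem (imagQuadEmb d t) θ n‖
      + ‖padeDen (imagQuadEmb d t) n‖ * ‖imagQuadEmb d x * θ - imagQuadEmb d y‖ := by
    intro h
    have h1 : (padeContent n : ℝ) ≤ ‖(padeContent n : ℂ) * imagQuadEmb d a‖ := by
      rw [norm_mul, Complex.norm_natCast]
      have := one_le_norm_imagQuadEmb h
      nlinarith
    rw [← ha] at h1
    refine h1.trans ((norm_add_le _ _).trans ?_)
    rw [norm_mul, norm_mul]
  cases n with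
  -- At index `0` the linear form is `-y`, which is nonzero, and `|xθ - y| ≤ 1/10` is too small to
  -- allow it.
  | zero =>
    have hny : padeNum (imagQuadEmb d t) 0 * imagQuadEmb d x
        - padeDen (imagQuadEmb d t) 0 * imagQuadEmb d y = - imagQuadEmb d y := by
      simp [padeNum, padeDen, padeSeq]
    have ha0 : a ≠ 0 := by
      rintro rfl
      rw [← linearForm_eq, hny, map_zero, mul_zero, neg_eq_zero] at ha
      have := one_le_norm_imagQuadEmb hy
      rw [ha, norm_zero] at this
      norm_num at this
    have h1 := hlow ha0
    have h2 : ‖padeDen (imagQuadEmb d t) 0‖ = 1 := by simp [padeDen, padeSeq]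
    have h3 : ‖imagQuadEmb d x * θ - imagQuadEmb d y‖ * (100 * 1 ^ 3) ≤ 10 := by
      refine le_trans ?_ hclose
      gcongr
    rw [h2] at h1
    linarith
  | succ k =>
    have hg : (1 : ℝ) ≤ padeContent k := by exact_mod_cast padeContent_pos k
    have hgR := not_lt.mp (hmin k (Nat.lt_succ_self k))
    have hp := hprod k
    have hk := padeContent_lower k
    have hk' := padeContent_lower (k + 1)
    have hkpos : (0 : ℝ) < (k + 1) ^ 2 := by positivity
    -- The constant `380/21` is the quotient of `38/10000` in `padeContent_lower` by `21/100000` in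
    -- the product bound.
    have hM : 380 * (‖padeDen (imagQuadEmb d t) (k + 1)‖ * ‖padeRem (imagQuadEmb d t) θ k‖ ^ 3)
        ≤ 21 * (padeContent k : ℝ) ^ 4 := by
      refine le_of_mul_le_mul_left ?_ hkpos
      linarith
    by_cases h0 : a = 0
    · rw [h0, map_zero, mul_zero] at ha
      have h1 : ‖imagQuadEmb d x‖ * ‖padeRem (imagQuadEmb d t) θ (k + 1)‖
          = ‖padeDen (imagQuadEmb d t) (k + 1)‖ * ‖imagQuadEmb d x * θ - imagQuadEmb d y‖ := by
        rw [← norm_mul, ← norm_mul, eq_neg_of_add_eq_zero_left ha, norm_neg]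
      exact estimate_of_vanishing hX0 (norm_nonneg _) (norm_nonneg _) hg hclose h1
        (hback k) hgR hM
    · refine estimate_of_ne_zero ht hX0 (norm_nonneg _) (norm_nonneg _) hg hG hclose (hlow h0) hn hgR
        hM ?_
      refine le_of_mul_le_mul_left ?_ hkpos
      push_cast at hk'
      rw [pow_succ] at hk'
      have h4 : ((k : ℝ) + 1 + 1) ^ 2 ≤ 4 * (k + 1) ^ 2 := by
        nlinarith [k.cast_nonneg (α := ℝ)]
      have h5 : ((k : ℝ) + 1 + 1) ^ 2 * (padeContent (k + 1) : ℝ) ^ 4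
          ≤ 4 * (k + 1) ^ 2 * (padeContent (k + 1) : ℝ) ^ 4 := by gcongr
      have h6 : (0 : ℝ) ≤ (1652 / 1000) ^ k := by positivity
      linarith

/-! ### Geometry of the four linear factors -/

lemma simplestQuartic_factor {t θ : ℂ} (h : t * (θ - θ ^ 3) = 1 - 6 * θ ^ 2 + θ ^ 4) (x y : ℂ) :
    θ * (1 - θ ^ 2) * simplestQuartic t x y =
      (x * θ - y) * (x + θ * y) * ((x + y) - θ * (x - y)) * ((x - y) + θ * (x + y)) := by
  rw [simplestQuartic]
  linear_combination (-x ^ 3 * y + x * y ^ 3) * h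

lemma simplestQuartic_rotate {R : Type*} [CommRing R] (t x y : R) :
    simplestQuartic t (-y) x = simplestQuartic t x y := by
  simp only [simplestQuartic]
  ring

lemma simplestQuartic_diagonal {R : Type*} [CommRing R] (t x y : R) :
    simplestQuartic t (x - y) (x + y) = -4 * simplestQuartic t x y := by
  simp only [simplestQuartic]
  ring

lemma norm_add_mul_lower {u v θ : ℂ} {c : ℝ} (hθ : ‖θ‖ ≤ 1 / 50) (hc : ‖v‖ ≤ c * ‖u‖) :
    (1 - c / 50) * ‖u‖ ≤ ‖u + θ * v‖ := by
  have h1 : ‖u‖ ≤ ‖u + θ * v‖ + ‖θ * v‖ := by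
    have := norm_sub_le (u + θ * v) (θ * v)
    rwa [add_sub_cancel_right] at this
  have h2 : ‖θ * v‖ ≤ 1 / 50 * (c * ‖u‖) := by
    rw [norm_mul]
    gcongr
  linarith

/-- Three of the four factors are comparable to `|x|`, since `|y| ≤ |x|/3` and `θ` is small. The
fourth is therefore at most about `4 |θ| / |x|^3`, and `|θ|` is about `1/|t|`. The bound `4` for the
form accommodates the diagonal substitution. -/
lemma close_of_norm_le {t θ x y : ℂ} (hθ0 : θ ≠ 0) (ht : 100 ≤ ‖t‖)
    (hθ : ‖t‖ * ‖θ‖ ≤ 101 / 100)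
    (h : t * (θ - θ ^ 3) = 1 - 6 * θ ^ 2 + θ ^ 4) (hxy : 3 * ‖y‖ ≤ ‖x‖)
    (hF : ‖simplestQuartic t x y‖ ≤ 4) : ‖x * θ - y‖ * (‖t‖ * ‖x‖ ^ 3) ≤ 10 := by
  have hθs : ‖θ‖ ≤ 101 / 10000 := by nlinarith [norm_nonneg θ]
  have h2 : ‖x‖ ≤ ‖x + θ * y‖ + ‖θ‖ * ‖y‖ := by
    have := norm_sub_le (x + θ * y) (θ * y)
    rwa [add_sub_cancel_right, norm_mul] at this
  have hu : ‖x + y‖ ≤ 4 / 3 * ‖x‖ := (norm_add_le _ _).trans (by linarith)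
  have hv : ‖x - y‖ ≤ 4 / 3 * ‖x‖ := (norm_sub_le _ _).trans (by linarith)
  have hu' : 2 / 3 * ‖x‖ ≤ ‖x + y‖ := by
    have := norm_sub_le (x + y) y
    rw [add_sub_cancel_right] at this
    linarith
  have hv' : 2 / 3 * ‖x‖ ≤ ‖x - y‖ := by
    have := norm_add_le (x - y) y
    rw [sub_add_cancel] at this
    linarith
  have h3 : ‖x + y‖ ≤ ‖(x + y) - θ * (x - y)‖ + ‖θ‖ * ‖x - y‖ := by
    have := norm_add_le ((x + y) - θ * (x - y)) (θ * (x - y))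
    rwa [sub_add_cancel, norm_mul] at this
  have h4 : ‖x - y‖ ≤ ‖(x - y) + θ * (x + y)‖ + ‖θ‖ * ‖x + y‖ := by
    have := norm_sub_le ((x - y) + θ * (x + y)) (θ * (x + y))
    rwa [add_sub_cancel_right, norm_mul] at this
  have b2 : 996 / 1000 * ‖x‖ ≤ ‖x + θ * y‖ := by
    have : ‖θ‖ * ‖y‖ ≤ 101 / 10000 * (‖x‖ / 3) := by
      gcongr
      linarith
    linarith [norm_nonneg x]
  have b3 : 653 / 1000 * ‖x‖ ≤ ‖(x + y) - θ * (x - y)‖ := by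
    have : ‖θ‖ * ‖x - y‖ ≤ 101 / 10000 * (4 / 3 * ‖x‖) := by gcongr
    linarith [norm_nonneg x]
  have b4 : 653 / 1000 * ‖x‖ ≤ ‖(x - y) + θ * (x + y)‖ := by
    have : ‖θ‖ * ‖x + y‖ ≤ 101 / 10000 * (4 / 3 * ‖x‖) := by gcongr
    linarith [norm_nonneg x]
  have hfac := congrArg norm (simplestQuartic_factor h x y)
  simp only [norm_mul] at hfac
  have h5 : ‖1 - θ ^ 2‖ ≤ 1001 / 1000 := by
    refine (norm_sub_le _ _).trans ?_
    rw [norm_one, norm_pow]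
    nlinarith [norm_nonneg θ]
  have h6 : ‖x * θ - y‖ * (996 / 1000 * ‖x‖) * (653 / 1000 * ‖x‖) * (653 / 1000 * ‖x‖)
      ≤ ‖θ‖ * (1001 / 1000) * 4 := by
    calc _ ≤ ‖x * θ - y‖ * ‖x + θ * y‖ * ‖(x + y) - θ * (x - y)‖ * ‖(x - y) + θ * (x + y)‖ := by
          gcongr
      _ = ‖θ‖ * ‖1 - θ ^ 2‖ * ‖simplestQuartic t x y‖ := hfac.symm
      _ ≤ _ := by gcongr
  have h7 : ‖t‖ * (‖x * θ - y‖ * (996 / 1000 * ‖x‖) * (653 / 1000 * ‖x‖) * (653 / 1000 * ‖x‖))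
      ≤ ‖t‖ * (‖θ‖ * (1001 / 1000) * 4) := by gcongr
  have h8 : 0 ≤ ‖x * θ - y‖ * (‖t‖ * ‖x‖ ^ 3) := by positivity
  nlinarith

/-- Each linear factor is a number of absolute value at least `1` perturbed by `θ` times its
partner, hence at least `9/10`. The product of the four would be tiny if the form were at most `1`,
because of the factor `θ` in `simplestQuartic_factor`. -/
lemma lower_of_generic {t θ x y : ℂ} (hθ : ‖θ‖ ≤ 101 / 10000)
    (h : t * (θ - θ ^ 3) = 1 - 6 * θ ^ 2 + θ ^ 4)
    (hx : 1 ≤ ‖x‖) (hy : 1 ≤ ‖y‖) (hu : 1 ≤ ‖x - y‖) (hv : 1 ≤ ‖x + y‖)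
    (h1 : ‖x‖ ≤ 3 * ‖y‖) (h2 : ‖y‖ ≤ 3 * ‖x‖) (h3 : ‖x - y‖ ≤ 3 * ‖x + y‖)
    (h4 : ‖x + y‖ ≤ 3 * ‖x - y‖) : 1 < ‖simplestQuartic t x y‖ := by
  have hθ' : ‖θ‖ ≤ 1 / 50 := by linarith
  have hθn : ‖-θ‖ ≤ 1 / 50 := by rwa [norm_neg]
  have b1 : 9 / 10 ≤ ‖x * θ - y‖ := by
    have := norm_add_mul_lower hθn h1
    rw [show x * θ - y = -(y + -θ * x) by ring, norm_neg]
    linarith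
  have b2 : 9 / 10 ≤ ‖x + θ * y‖ := by
    have := norm_add_mul_lower hθ' h2
    linarith
  have b3 : 9 / 10 ≤ ‖(x + y) - θ * (x - y)‖ := by
    have := norm_add_mul_lower hθn h3
    rw [show (x + y) - θ * (x - y) = (x + y) + -θ * (x - y) by ring]
    linarith
  have b4 : 9 / 10 ≤ ‖(x - y) + θ * (x + y)‖ := by
    have := norm_add_mul_lower hθ' h4
    linarith
  have hfac := congrArg norm (simplestQuartic_factor h x y)
  simp only [norm_mul] at hfac
  have h5 : ‖1 - θ ^ 2‖ ≤ 2 := by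
    refine (norm_sub_le _ _).trans ?_
    rw [norm_one, norm_pow]
    nlinarith [norm_nonneg θ]
  by_contra! hle
  have h6 : (9 / 10 : ℝ) * (9 / 10) * (9 / 10) * (9 / 10) ≤ 101 / 10000 * 2 * 1 := by
    calc _ ≤ ‖x * θ - y‖ * ‖x + θ * y‖ * ‖(x + y) - θ * (x - y)‖ * ‖(x - y) + θ * (x + y)‖ := by
          gcongr
      _ = ‖θ‖ * ‖1 - θ ^ 2‖ * ‖simplestQuartic t x y‖ := hfac.symm
      _ ≤ _ := by gcongr
  norm_num at h6

theorem eq_zero_of_norm_le {d : ℕ} {t x y : 𝓞 (imagQuadField d)} (ht : 100 ≤ imagQuadAbs t)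
    (hxy : 3 * imagQuadAbs y ≤ imagQuadAbs x) (hF : imagQuadAbs (simplestQuartic t x y) ≤ 4) :
    y = 0 := by
  simp only [← norm_imagQuadEmb] at ht hxy hF
  rw [imagQuadEmb_simplestQuartic] at hF
  by_cases hx : x = 0
  · by_contra hy
    have := one_le_norm_imagQuadEmb hy
    rw [hx, map_zero, norm_zero] at hxy
    linarith
  · obtain ⟨θ, h0, h1, h2, h3, h4, -, h5⟩ := exists_padeApproximation ht
    exact eq_zero_of_close ht hx h3 h4 h5 (close_of_norm_le h0 ht h1 h2 hxy hF)

lemma trivial_of_fourth_power {d : ℕ} {x : 𝓞 (imagQuadField d)} (h : imagQuadAbs (x ^ 4) ≤ 1) :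
    x = 0 ∨ IsUnityRoot x := by
  rw [or_iff_not_imp_left]
  intro hx
  have h1 := one_le_imagQuadAbs hx
  rw [← norm_imagQuadEmb, map_pow, norm_pow, norm_imagQuadEmb] at h
  refine isUnityRoot_of_abs_eq_one (le_antisymm ?_ h1)
  by_contra! hlt
  have := one_lt_pow₀ hlt (by norm_num : 4 ≠ 0)
  linarith

theorem theorem2p1 (d : ℕ) (hd : Squarefree d) (t : 𝓞 (imagQuadField d))
    (ht : 100 ≤ imagQuadAbs t) (x y : 𝓞 (imagQuadField d))
    (hxy : imagQuadAbs (simplestQuartic t x y) ≤ 1) :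
    (x = 0 ∧ y = 0) ∨ (∃ ξ : 𝓞 (imagQuadField d), IsUnityRoot ξ ∧
      ((x = ξ ∧ y = 0) ∨ (x = 0 ∧ y = ξ))) := by
  have hneg : ∀ z : 𝓞 (imagQuadField d), imagQuadAbs (-z) = imagQuadAbs z := fun z => by
    rw [← norm_imagQuadEmb, map_neg, norm_neg, norm_imagQuadEmb]
  by_cases h1 : 3 * imagQuadAbs y ≤ imagQuadAbs x
  · have hy := eq_zero_of_norm_le ht h1 (hxy.trans (by norm_num))
    subst hy
    have : simplestQuartic t x 0 = x ^ 4 := by simp only [simplestQuartic]; ring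
    rw [this] at hxy
    rcases trivial_of_fourth_power hxy with h | h
    · exact Or.inl ⟨h, rfl⟩
    · exact Or.inr ⟨x, h, Or.inl ⟨rfl, rfl⟩⟩
  by_cases h2 : 3 * imagQuadAbs x ≤ imagQuadAbs y
  · have hx := eq_zero_of_norm_le (x := -y) (y := x) ht (by rwa [hneg])
      (by rw [simplestQuartic_rotate]; linarith)
    subst hx
    have : simplestQuartic t 0 y = y ^ 4 := by simp only [simplestQuartic]; ring
    rw [this] at hxy
    rcases trivial_of_fourth_power hxy with h | h
    · exact Or.inl ⟨rfl, h⟩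
    · exact Or.inr ⟨y, h, Or.inr ⟨rfl, rfl⟩⟩
  exfalso
  push Not at h1 h2
  have hx0 : x ≠ 0 := by
    rintro rfl
    rw [← norm_imagQuadEmb 0, map_zero, norm_zero, mul_zero, ← norm_imagQuadEmb] at h2
    exact absurd h2 (not_lt.mpr (norm_nonneg _))
  have hy0 : y ≠ 0 := by
    rintro rfl
    rw [← norm_imagQuadEmb 0, map_zero, norm_zero, mul_zero, ← norm_imagQuadEmb] at h1
    exact absurd h1 (not_lt.mpr (norm_nonneg _))
  have hF4 : imagQuadAbs (simplestQuartic t (x - y) (x + y)) ≤ 4 := by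
    rw [simplestQuartic_diagonal, imagQuadAbs_neg_four_mul]
    linarith
  have hdiag : ∀ z : 𝓞 (imagQuadField d), z ≠ 0 → 1 < imagQuadAbs (-4 * z ^ 4) := by
    intro z hz
    have := one_le_imagQuadAbs (pow_ne_zero 4 hz)
    rw [imagQuadAbs_neg_four_mul]
    linarith
  -- Near the two diagonal roots the pair `(x - y, x + y)` is used. It forces `y = ±x`, where the
  -- form equals `-4 x^4` and so exceeds `1` in absolute value.
  by_cases h3 : 3 * imagQuadAbs (x + y) ≤ imagQuadAbs (x - y)
  · have h := eq_zero_of_norm_le ht h3 hF4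
    have hy : y = -x := by linear_combination h
    have : simplestQuartic t x y = -4 * x ^ 4 := by rw [hy]; simp only [simplestQuartic]; ring
    rw [this] at hxy
    linarith [hdiag x hx0]
  by_cases h4 : 3 * imagQuadAbs (x - y) ≤ imagQuadAbs (x + y)
  · have h := eq_zero_of_norm_le (x := -(x + y)) (y := x - y) ht (by rwa [hneg])
      (by rwa [simplestQuartic_rotate])
    have hy : y = x := by linear_combination -h
    have : simplestQuartic t x y = -4 * x ^ 4 := by rw [hy]; simp only [simplestQuartic]; ring
    rw [this] at hxy
    linarith [hdiag x hx0]
  push Not at h3 h4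
  have hu0 : x - y ≠ 0 := by
    intro h
    rw [h, ← norm_imagQuadEmb 0, map_zero, norm_zero, mul_zero, ← norm_imagQuadEmb] at h4
    exact absurd h4 (not_lt.mpr (norm_nonneg _))
  have hv0 : x + y ≠ 0 := by
    intro h
    rw [h, ← norm_imagQuadEmb 0, map_zero, norm_zero, mul_zero, ← norm_imagQuadEmb] at h3
    exact absurd h3 (not_lt.mpr (norm_nonneg _))
  have n1 := one_le_norm_imagQuadEmb hx0
  have n2 := one_le_norm_imagQuadEmb hy0
  have n3 := one_le_norm_imagQuadEmb hu0
  have n4 := one_le_norm_imagQuadEmb hv0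
  simp only [← norm_imagQuadEmb] at ht h1 h2 h3 h4 hxy
  rw [imagQuadEmb_simplestQuartic] at hxy
  simp only [map_sub, map_add] at n3 n4 h3 h4
  obtain ⟨θ, -, hθ, hrel, -⟩ := exists_padeApproximation ht
  have hθs : ‖θ‖ ≤ 101 / 10000 := by nlinarith [norm_nonneg θ]
  have := lower_of_generic hθs hrel n1 n2 n3 n4 h1.le h2.le h3.le h4.le
  linarith
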